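/- For an integer $Q\ge 2$ let $M(Q)$ be the finite sequence of all fractions $p/q$ indexed by the pairs of integers $(p,q)$ with $1\le p<q\le Q$ (so that equal fractions are counted with multiplicity), and let $N=N(Q)=Q(Q-1)/2$ be its number of terms $x_1,\dots,x_N$. Let $I\subset(0,1)$ be any interval of positive length $|I|$. For $\lambda>0$ put $$R_{I,Q}(\lambda)=\frac{1}{2N|I|}\,\#\Big\{(i,j): 1\le i,j\le N,\ i\neq j,\ x_i,x_j\in I,\ 0<|x_i-x_j|\le \frac{\lambda}{N}\Big\}.$$ Let $$g(x)=\frac{6}{\pi^2x^2}\sum_{1\le k\le 2x}\sigma(k)\log\frac{2x}{k}\qquad(x>0),$$ where $\sigma(k)$ is the sum of the positive divisors of $k$. Then the limiting pair correlation function of $(M(Q)\cap I)_{Q}$ exists and equals $g$, independently of $I$; that is, for every $\lambda>0$ the function $g$ is integrable on $(0,\lambda]$ and $$\lim_{Q\to\infty}R_{I,Q}(\lambda)=\int_0^\lambda g(x)\,dx .$$ -/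

import Mathlib

open MeasureTheory Filter Topology

noncomputable section

namespace FracPairCorr

/-- Index set of the finite sequence `M(Q)`: the pairs `(p, q)` with `1 ≤ p < q ≤ Q`. The entry with
index `(p, q)` is the fraction `p / q`, so equal fractions are kept with their multiplicity. -/
def indices (Q : ℕ) : Finset (ℕ × ℕ) :=
  (Finset.Icc 1 Q ×ˢ Finset.Icc 1 Q).filter fun i => i.1 < i.2

/-- The entry `p / q` of `M(Q)` with index `(p, q)`. -/
def point (i : ℕ × ℕ) : ℝ := (i.1 : ℝ) / (i.2 : ℝ)

/-- The number `N = Q (Q - 1) / 2` of entries of `M(Q)`. -/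
def numPoints (Q : ℕ) : ℝ := (Q : ℝ) * ((Q : ℝ) - 1) / 2

open scoped Classical in
/-- The ordered pairs of distinct indices of entries of `M(Q)` lying in `I` whose values are
different and at distance at most `lam / N`. -/
def closePairs (I : Set ℝ) (Q : ℕ) (lam : ℝ) : Finset ((ℕ × ℕ) × (ℕ × ℕ)) :=
  (indices Q ×ˢ indices Q).filter fun ij =>
    point ij.1 ∈ I ∧ point ij.2 ∈ I ∧ ij.1 ≠ ij.2 ∧
      0 < |point ij.1 - point ij.2| ∧ |point ij.1 - point ij.2| ≤ lam / numPoints Q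

/-- `R_{M_I(Q)}(lam)`: the number of close pairs divided by `2 N |I|`, with `|I|` the length of the
interval `I`. -/
def pairCorr (I : Set ℝ) (Q : ℕ) (lam : ℝ) : ℝ :=
  ((closePairs I Q lam).card : ℝ) / (2 * numPoints Q * volume.real I)

/-- `g` is the pair correlation function of `(M(Q) ∩ I)_Q`: for every `lam > 0` the limit of
`R_{M_I(Q)}(lam)` as `Q → ∞` exists and equals the (convergent) integral of `g` over `[0, lam]`. -/
def IsPairCorrelationFunction (I : Set ℝ) (g : ℝ → ℝ) : Prop :=
  ∀ lam : ℝ, 0 < lam →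
    IntervalIntegrable g volume 0 lam ∧
      Tendsto (fun Q : ℕ => pairCorr I Q lam) atTop (𝓝 (∫ x in (0 : ℝ)..lam, g x))

/-- `x ↦ 6 / (π² x²) * ∑_{1 ≤ k ≤ 2 x} σ(k) log (2 x / k)`. -/
def density (x : ℝ) : ℝ :=
  6 / (Real.pi ^ 2 * x ^ 2) *
    ∑ k ∈ Finset.Icc 1 ⌊2 * x⌋₊,
      (ArithmeticFunction.sigma 1 k : ℝ) * Real.log (2 * x / (k : ℝ))

end FracPairCorr

end

noncomputable section

namespace FracPairCorr

/-! A positive difference p/q - p'/q' equals k/(qq') with k = pq' - p'q ≥ 1. As N ~ Q²/2, it is at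
most λ/N essentially when qq' ≥ cQ² with c = k/(2λ), and q, q' ≤ Q leaves only k ≤ 2λ. What is
needed is that the pairs of determinant k with qq' ≥ cQ² and both fractions in an interval of length
ℓ number about `meanWeight k * hyperbolaArea c` · ℓQ². Summing over k and differentiating in λ then
produces g.

Upper bound, without localisation: given q and q', there are at most gcd(q, q') admissible numerator
pairs, and none unless gcd(q, q') divides k. Möbius inversion gives this weight the mean
6σ(k)/(π²k), and the part xy ≥ c of the unit square has area 1 - c + c log c
(`eventually_sum_gcdWeight_hyperbola_le`, `card_detPairs_le`).

Lower bound, in any interval: restrict q'/q to a short range just above a rational n/m and put D =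
q'm - qn, a = p'm - pn. Then p/q = a/D + km/(qD), so up to a vanishing error the position of p/q is
that of a/D, and (D, a) is an unconstrained lattice point of a trapezoid. Conversely each (D, a)
with gcd(D, a) ∣ k lifts to about gcd(D, a)(1/θ₁ - 1/θ₂) pairs, so the same gcd sums reappear
(`sum_gcdWeight_le_card_sectorPairs`). A Vitali covering by such slope ranges recovers the full
constant (`eventually_le_card_detPairs`).

The lower bounds for I and for the two complementary intervals of (0, 1) add up to the global upper
bound, so each of them is sharp (`tendsto_card_posPairs`). -/

open scoped Pointwise

/-! ### Lattice points in star-shaped regions -/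

open scoped Classical in
/-- The pairs of integers in `[1, Q]²` whose dilate by `1 / Q` lies in `S`. -/
def latticePoints (S : Set (ℝ × ℝ)) (Q : ℕ) : Finset (ℕ × ℕ) :=
  (Finset.Icc 1 Q ×ˢ Finset.Icc 1 Q).filter fun v => ((v.1 : ℝ) / Q, (v.2 : ℝ) / Q) ∈ S

theorem mem_latticePoints {S : Set (ℝ × ℝ)} {Q : ℕ} {v : ℕ × ℕ} :
    v ∈ latticePoints S Q ↔
      ((1 ≤ v.1 ∧ v.1 ≤ Q) ∧ (1 ≤ v.2 ∧ v.2 ≤ Q)) ∧ ((v.1 : ℝ) / Q, (v.2 : ℝ) / Q) ∈ S := by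
  simp [latticePoints]

/-- Subsets of `(0, 1]²` that are star-shaped about the origin and Jordan measurable. -/
structure IsStarRegion (S : Set (ℝ × ℝ)) : Prop where
  subset : S ⊆ Set.Ioc 0 1 ×ˢ Set.Ioc 0 1
  measurable : MeasurableSet S
  frontier_null : volume (frontier S) = 0
  star : ∀ p ∈ S, ∀ t : ℝ, 0 < t → t ≤ 1 → (t * p.1, t * p.2) ∈ S

/-- After scaling by 1/Q, the pairs divisible by e are the points of (e/Q)ℤ² in S. Since S lies in
(0, 1]², the bounds 1 and Q on the coordinates are automatic. -/
theorem card_multiples_eq {S : Set (ℝ × ℝ)} (hS : IsStarRegion S) {e : ℕ} (he : 0 < e)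
    {Q : ℕ} (hQ : 0 < Q) :
    ((latticePoints S Q).filter fun v => e ∣ v.1 ∧ e ∣ v.2).card =
      Nat.card ↑((MeasurableEquiv.finTwoArrow ⁻¹' S : Set (Fin 2 → ℝ)) ∩
        ((Q : ℝ) / e)⁻¹ • (Submodule.span ℤ (Set.range (Pi.basisFun ℝ (Fin 2))) :
          Set (Fin 2 → ℝ))) := by
  have he' : (0 : ℝ) < e := by exact_mod_cast he
  have hQ' : (0 : ℝ) < Q := by exact_mod_cast hQ
  have hx : (Q : ℝ) / e ≠ 0 := by positivity
  rw [← Set.ncard_coe_finset, Nat.card_coe_set_eq]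
  refine Set.ncard_congr (fun v _ => ![(v.1 : ℝ) / Q, (v.2 : ℝ) / Q]) ?_ ?_ ?_
  · rintro ⟨a, b⟩ hv
    simp only [Finset.coe_filter, Set.mem_ofPred_eq, mem_latticePoints] at hv
    obtain ⟨⟨_, hvS⟩, ⟨a', rfl⟩, ⟨b', rfl⟩⟩ := hv
    refine ⟨by simpa [MeasurableEquiv.finTwoArrow, MeasurableEquiv.piFinTwo] using hvS, ?_⟩
    rw [Set.mem_inv_smul_set_iff₀ hx, SetLike.mem_coe, Module.Basis.mem_span_iff_repr_mem]
    intro i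
    fin_cases i
    · refine ⟨a', ?_⟩
      simp
      field_simp
    · refine ⟨b', ?_⟩
      simp
      field_simp
  · rintro ⟨a, b⟩ ⟨a', b'⟩ _ _ h
    have h0 := congrFun h 0
    have h1 := congrFun h 1
    simp only [Matrix.cons_val_zero, Matrix.cons_val_one] at h0 h1
    rw [div_left_inj' hQ'.ne'] at h0 h1
    exact Prod.ext (by exact_mod_cast h0) (by exact_mod_cast h1)
  · rintro x ⟨hxS, hxL⟩
    rw [Set.mem_inv_smul_set_iff₀ hx, SetLike.mem_coe, Module.Basis.mem_span_iff_repr_mem] at hxL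
    have hxS' : (x 0, x 1) ∈ S := hxS
    obtain ⟨⟨h00, h01⟩, ⟨h10, h11⟩⟩ := hS.subset hxS'
    simp only at h00 h01 h10 h11
    have key : ∀ i, 0 < x i → x i ≤ 1 → ∃ a : ℕ, e ∣ a ∧ 1 ≤ a ∧ a ≤ Q ∧ (a : ℝ) / Q = x i := by
      intro i h0 h1
      obtain ⟨z, hz⟩ := hxL i
      simp only [Pi.basisFun_repr, Pi.smul_apply, smul_eq_mul, algebraMap_int_eq,
        eq_intCast] at hz
      have hzpos : 0 < z := by
        have : (0 : ℝ) < z := by rw [hz]; positivity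
        exact_mod_cast this
      lift z to ℕ using hzpos.le
      have hzx : ((e * z : ℕ) : ℝ) = Q * x i := by
        push_cast
        have : ((z : ℤ) : ℝ) = z := by simp
        rw [← this, hz]
        field_simp
      refine ⟨e * z, dvd_mul_right _ _, Nat.mul_pos he (by exact_mod_cast hzpos), ?_, ?_⟩
      · have : ((e * z : ℕ) : ℝ) ≤ Q := by rw [hzx]; nlinarith
        exact_mod_cast this
      · rw [hzx]; field_simp
    obtain ⟨a, ha, ha1, ha2, ha3⟩ := key 0 h00 h01
    obtain ⟨b, hb, hb1, hb2, hb3⟩ := key 1 h10 h11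
    refine ⟨(a, b), ?_, ?_⟩
    · simp only [Finset.coe_filter, Set.mem_ofPred_eq, mem_latticePoints, ha3, hb3]
      exact ⟨⟨⟨⟨ha1, ha2⟩, ⟨hb1, hb2⟩⟩, hxS'⟩, ha, hb⟩
    · ext i
      fin_cases i
      · exact ha3
      · exact hb3

/-- The dilation factor Q/e is not an integer, so the lattice point count is needed along a real
parameter. That version requires the dilates of S to increase, which is what star-shapedness
provides. -/
theorem tendsto_card_multiples {S : Set (ℝ × ℝ)} (hS : IsStarRegion S) {e : ℕ} (he : 0 < e) :
    Tendsto (fun Q : ℕ => (((latticePoints S Q).filter fun v => e ∣ v.1 ∧ e ∣ v.2).card : ℝ) /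
      (Q : ℝ) ^ 2) atTop (𝓝 (volume.real S / (e : ℝ) ^ 2)) := by
  have he' : (0 : ℝ) < e := by exact_mod_cast he
  have hvol : volume.real (MeasurableEquiv.finTwoArrow ⁻¹' S : Set (Fin 2 → ℝ)) =
      volume.real S :=
    (volume_preserving_finTwoArrow ℝ).measureReal_preimage hS.measurable.nullMeasurableSet
  have hlim := tendsto_card_div_pow_atTop_volume'
    (MeasurableEquiv.finTwoArrow ⁻¹' S : Set (Fin 2 → ℝ)) ?_ ?_ ?_ ?_
  · have hQe : Tendsto (fun Q : ℕ => (Q : ℝ) / e) atTop atTop :=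
      tendsto_natCast_atTop_atTop.atTop_div_const he'
    have := (hlim.comp hQe).div_const ((e : ℝ) ^ 2)
    rw [hvol] at this
    refine this.congr' ?_
    filter_upwards [eventually_gt_atTop 0] with Q hQ
    rw [card_multiples_eq hS he hQ]
    simp only [Function.comp, Fintype.card_fin]
    have hQ' : (0 : ℝ) < Q := by exact_mod_cast hQ
    field_simp
  · refine (Metric.isBounded_Icc (0 : Fin 2 → ℝ) 1).subset fun x hx => ?_
    obtain ⟨⟨h00, h01⟩, ⟨h10, h11⟩⟩ := hS.subset (show (x 0, x 1) ∈ S from hx)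
    constructor <;> intro i <;> fin_cases i
    exacts [h00.le, h10.le, h01, h11]
  · exact MeasurableEquiv.finTwoArrow.measurable hS.measurable
  · have : frontier (MeasurableEquiv.finTwoArrow ⁻¹' S : Set (Fin 2 → ℝ)) =
        MeasurableEquiv.finTwoArrow ⁻¹' frontier S :=
      ((Homeomorph.finTwoArrow (X := ℝ)).preimage_frontier S).symm
    rw [this, (volume_preserving_finTwoArrow ℝ).measure_preimage
      isClosed_frontier.measurableSet.nullMeasurableSet]
    exact hS.frontier_null
  · intro x y hx hxy p hp
    have hy : 0 < y := hx.trans_le hxy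
    rw [Set.mem_smul_set_iff_inv_smul_mem₀ hx.ne'] at hp
    rw [Set.mem_smul_set_iff_inv_smul_mem₀ hy.ne']
    have := hS.star _ (show ((x⁻¹ • p) 0, (x⁻¹ • p) 1) ∈ S from hp) (x / y) (by positivity)
      ((div_le_one hy).2 hxy)
    have h2 : ((y⁻¹ • p) 0, (y⁻¹ • p) 1) ∈ S := by
      convert this using 2
      · simp; field_simp
      · simp; field_simp
    exact h2

theorem card_multiples_le (S : Set (ℝ × ℝ)) {e : ℕ} (he : 0 < e) (Q : ℕ) :
    (((latticePoints S Q).filter fun v => e ∣ v.1 ∧ e ∣ v.2).card : ℝ) ≤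
      (Q : ℝ) ^ 2 / (e : ℝ) ^ 2 := by
  have h1 : ((latticePoints S Q).filter fun v => e ∣ v.1 ∧ e ∣ v.2) ⊆
      ((Finset.Ioc 0 Q).filter (e ∣ ·)) ×ˢ ((Finset.Ioc 0 Q).filter (e ∣ ·)) := by
    intro v hv
    simp only [Finset.mem_filter, mem_latticePoints] at hv
    simp only [Finset.mem_product, Finset.mem_filter, Finset.mem_Ioc]
    omega
  have h2 := Finset.card_le_card h1
  rw [Finset.card_product, Nat.Ioc_filter_dvd_card_eq_div] at h2
  have h3 : ((Q / e : ℕ) : ℝ) ≤ (Q : ℝ) / e := Nat.cast_div_le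
  calc (((latticePoints S Q).filter fun v => e ∣ v.1 ∧ e ∣ v.2).card : ℝ)
      ≤ ((Q / e : ℕ) : ℝ) * ((Q / e : ℕ) : ℝ) := by exact_mod_cast h2
    _ ≤ ((Q : ℝ) / e) * ((Q : ℝ) / e) := by gcongr
    _ = _ := by ring

/-! ### Möbius inversion: pairs with prescribed gcd -/

theorem tsum_moebius_div_sq :
    ∑' f : ℕ, (ArithmeticFunction.moebius f : ℝ) / (f : ℝ) ^ 2 = 6 / Real.pi ^ 2 := by
  have h := ArithmeticFunction.LSeries_zeta_mul_Lseries_moebius (s := 2) (by norm_num)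
  rw [ArithmeticFunction.LSeries_zeta_eq_riemannZeta (by norm_num), riemannZeta_two] at h
  have h2 : LSeries (fun n => ((ArithmeticFunction.moebius n : ℤ) : ℂ)) 2 =
      ((∑' f : ℕ, (ArithmeticFunction.moebius f : ℝ) / (f : ℝ) ^ 2 : ℝ) : ℂ) := by
    rw [LSeries, Complex.ofReal_tsum]
    refine tsum_congr fun n => ?_
    rw [LSeries.term_def]
    split_ifs with hn
    · simp [hn]
    · push_cast
      norm_num
  rw [h2] at h
  have h3 : Real.pi ^ 2 / 6 *
      (∑' f : ℕ, (ArithmeticFunction.moebius f : ℝ) / (f : ℝ) ^ 2) = 1 := by exact_mod_cast h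
  have hpi := Real.pi_pos
  rw [eq_div_iff (by positivity)]
  linarith

theorem sum_moebius_of_dvd {g d Q : ℕ} (hg : 0 < g) (hgQ : g ≤ Q) (hd : 0 < d) :
    ∑ f ∈ Finset.Icc 1 Q, (if d * f ∣ g then (ArithmeticFunction.moebius f : ℝ) else 0) =
      if g = d then 1 else 0 := by
  by_cases hdg : d ∣ g
  · obtain ⟨n, rfl⟩ := hdg
    have hn : 0 < n := Nat.pos_of_mul_pos_left hg
    have h1 : (Finset.Icc 1 Q).filter (fun f => d * f ∣ d * n) = n.divisors := by
      ext f
      simp only [Finset.mem_filter, Finset.mem_Icc, Nat.mem_divisors]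
      constructor
      · rintro ⟨_, h⟩
        exact ⟨Nat.dvd_of_mul_dvd_mul_left hd h, hn.ne'⟩
      · rintro ⟨h, _⟩
        exact ⟨⟨Nat.pos_of_dvd_of_pos h hn, (Nat.le_of_dvd hn h).trans
          ((Nat.le_mul_of_pos_left n hd).trans hgQ)⟩, Nat.mul_dvd_mul_left d h⟩
    rw [← Finset.sum_filter, h1]
    have h2 := congrArg (fun F : ArithmeticFunction ℤ => F n)
      ArithmeticFunction.coe_zeta_mul_moebius
    simp only [ArithmeticFunction.coe_zeta_mul_apply, ArithmeticFunction.one_apply] at h2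
    have h3 : d * n = d ↔ n = 1 := by
      constructor
      · intro h; exact Nat.eq_of_mul_eq_mul_left hd (by simpa using h)
      · rintro rfl; simp
    simp only [h3]
    exact_mod_cast h2
  · rw [if_neg (by rintro rfl; exact hdg dvd_rfl)]
    refine Finset.sum_eq_zero fun f _ => if_neg fun h => hdg ((dvd_mul_right d f).trans h)

/-- Möbius inversion, with range of summation independent of Q so that dominated convergence
applies. The extra terms vanish: μ(0) = 0, and no coordinate in [1, Q] is a multiple of df when f >
Q. -/
theorem card_gcd_eq_sum (S : Set (ℝ × ℝ)) {d : ℕ} (hd : 0 < d) (Q : ℕ) :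
    (((latticePoints S Q).filter fun v => Nat.gcd v.1 v.2 = d).card : ℝ) =
      ∑' f : ℕ, (ArithmeticFunction.moebius f : ℝ) *
        (((latticePoints S Q).filter fun v => d * f ∣ v.1 ∧ d * f ∣ v.2).card : ℝ) := by
  rw [tsum_eq_sum (s := Finset.Icc 1 Q)]
  · rw [Finset.card_filter]
    push_cast
    have : ∀ f ∈ Finset.Icc 1 Q, (ArithmeticFunction.moebius f : ℝ) *
        (((latticePoints S Q).filter fun v => d * f ∣ v.1 ∧ d * f ∣ v.2).card : ℝ) =
        ∑ v ∈ latticePoints S Q,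
          if d * f ∣ Nat.gcd v.1 v.2 then (ArithmeticFunction.moebius f : ℝ) else 0 := by
      intro f _
      rw [Finset.card_filter]
      push_cast
      rw [Finset.mul_sum]
      refine Finset.sum_congr rfl fun v _ => ?_
      simp only [Nat.dvd_gcd_iff, mul_ite, mul_one, mul_zero]
    rw [Finset.sum_congr rfl this, Finset.sum_comm]
    refine Finset.sum_congr rfl fun v hv => ?_
    rw [mem_latticePoints] at hv
    have h1 := Nat.gcd_pos_of_pos_left v.2 hv.1.1.1
    exact (sum_moebius_of_dvd h1 ((Nat.gcd_le_left _ hv.1.1.1).trans hv.1.1.2) hd).symm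
  · intro f hf
    rcases Nat.eq_zero_or_pos f with rfl | hf0
    · simp
    have hfQ : Q < f := by
      by_contra h
      exact hf (Finset.mem_Icc.2 ⟨hf0, not_lt.1 h⟩)
    rw [Finset.filter_eq_empty_iff.2]
    · simp
    · rintro v hv ⟨h1, _⟩
      rw [mem_latticePoints] at hv
      have := Nat.le_of_dvd hv.1.1.1 h1
      have := Nat.le_mul_of_pos_left f hd
      omega

theorem tendsto_card_gcd {S : Set (ℝ × ℝ)} (hS : IsStarRegion S) {d : ℕ} (hd : 0 < d) :
    Tendsto (fun Q : ℕ => (((latticePoints S Q).filter fun v => Nat.gcd v.1 v.2 = d).card : ℝ) /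
      (Q : ℝ) ^ 2) atTop (𝓝 (6 / Real.pi ^ 2 * volume.real S / (d : ℝ) ^ 2)) := by
  have hd' : (0 : ℝ) < d := by exact_mod_cast hd
  have hlim : Tendsto (fun Q : ℕ => ∑' f : ℕ, (ArithmeticFunction.moebius f : ℝ) *
      ((((latticePoints S Q).filter fun v => d * f ∣ v.1 ∧ d * f ∣ v.2).card : ℝ) / (Q : ℝ) ^ 2))
      atTop (𝓝 (∑' f : ℕ, (ArithmeticFunction.moebius f : ℝ) *
        (volume.real S / ((d * f : ℕ) : ℝ) ^ 2))) := by
    refine tendsto_tsum_of_dominated_convergence (bound := fun f : ℕ => 1 / (f : ℝ) ^ 2)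
      (Real.summable_one_div_nat_pow.2 one_lt_two) (fun f => ?_) ?_
    · rcases Nat.eq_zero_or_pos f with rfl | hf
      · simp
      · exact (tendsto_card_multiples hS (Nat.mul_pos hd hf)).const_mul _
    · filter_upwards [eventually_gt_atTop 0] with Q hQ f
      rcases Nat.eq_zero_or_pos f with rfl | hf
      · simp
      have hQ' : (0 : ℝ) < Q := by exact_mod_cast hQ
      have hf' : (0 : ℝ) < f := by exact_mod_cast hf
      have hd1 : (1 : ℝ) ≤ d := by exact_mod_cast hd
      rw [norm_mul, Real.norm_eq_abs, Real.norm_eq_abs, abs_of_nonneg (a := _ / _) (by positivity)]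
      have h1 : |(ArithmeticFunction.moebius f : ℝ)| ≤ 1 := by
        exact_mod_cast (ArithmeticFunction.abs_moebius_le_one (n := f))
      have h2 := card_multiples_le S (Nat.mul_pos hd hf) Q
      calc _ ≤ 1 * ((Q : ℝ) ^ 2 / ((d * f : ℕ) : ℝ) ^ 2 / (Q : ℝ) ^ 2) := by gcongr
        _ = 1 / ((d * f : ℕ) : ℝ) ^ 2 := by field_simp
        _ ≤ 1 / (f : ℝ) ^ 2 := by
          push_cast
          gcongr
          nlinarith
  have hsum : ∑' f : ℕ, (ArithmeticFunction.moebius f : ℝ) *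
      (volume.real S / ((d * f : ℕ) : ℝ) ^ 2) = 6 / Real.pi ^ 2 * volume.real S / (d : ℝ) ^ 2 := by
    rw [← tsum_moebius_div_sq, mul_div_assoc, ← tsum_mul_right]
    refine tsum_congr fun f => ?_
    push_cast
    rw [mul_pow]
    field_simp
  rw [hsum] at hlim
  refine hlim.congr fun Q => ?_
  rw [card_gcd_eq_sum S hd, ← tsum_div_const]
  exact tsum_congr fun f => (mul_div_assoc _ _ _).symm

/-! ### The mean value of the gcd weight -/

/-- The number of residues `t` modulo `x` with `t * y ≡ k`: it is `gcd x y` if this divides `k`,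
and `0` otherwise. -/
def gcdWeight (k : ℕ) (v : ℕ × ℕ) : ℕ := if Nat.gcd v.1 v.2 ∣ k then Nat.gcd v.1 v.2 else 0

/-- The mean value `6 σ(k) / (π² k)` of `gcdWeight k`. -/
def meanWeight (k : ℕ) : ℝ := 6 / Real.pi ^ 2 * ((ArithmeticFunction.sigma 1 k : ℝ) / k)

theorem meanWeight_nonneg (k : ℕ) : 0 ≤ meanWeight k := by
  unfold meanWeight
  positivity

/-- Pairs of gcd d have density 6/(π²d²) and weight d, for d ∣ k; the sum of 1/d over the divisors
of k is σ(k)/k. -/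
theorem tendsto_sum_gcdWeight {S : Set (ℝ × ℝ)} (hS : IsStarRegion S) {k : ℕ} (hk : 0 < k) :
    Tendsto (fun Q : ℕ => (∑ v ∈ latticePoints S Q, (gcdWeight k v : ℝ)) / (Q : ℝ) ^ 2) atTop
      (𝓝 (meanWeight k * volume.real S)) := by
  have h1 : ∀ v : ℕ × ℕ, (gcdWeight k v : ℝ) =
      ∑ d ∈ k.divisors, if Nat.gcd v.1 v.2 = d then (d : ℝ) else 0 := by
    intro v
    rw [Finset.sum_ite_eq, gcdWeight]
    simp [Nat.mem_divisors, hk.ne']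
  have h2 : ∀ Q : ℕ, (∑ v ∈ latticePoints S Q, (gcdWeight k v : ℝ)) / (Q : ℝ) ^ 2 =
      ∑ d ∈ k.divisors, (d : ℝ) *
        ((((latticePoints S Q).filter fun v => Nat.gcd v.1 v.2 = d).card : ℝ) / (Q : ℝ) ^ 2) := by
    intro Q
    simp only [h1]
    rw [Finset.sum_comm, Finset.sum_div]
    refine Finset.sum_congr rfl fun d _ => ?_
    rw [← Finset.sum_filter, Finset.sum_const, nsmul_eq_mul]
    ring
  simp only [h2]
  have h3 : meanWeight k * volume.real S =
      ∑ d ∈ k.divisors, (d : ℝ) * (6 / Real.pi ^ 2 * volume.real S / (d : ℝ) ^ 2) := by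
    have h4 : (ArithmeticFunction.sigma 1 k : ℝ) / k = ∑ d ∈ k.divisors, 1 / (d : ℝ) := by
      rw [ArithmeticFunction.sigma_one_apply, ← Nat.sum_div_divisors k (fun d => 1 / (d : ℝ))]
      push_cast
      rw [Finset.sum_div]
      refine Finset.sum_congr rfl fun d hd => ?_
      have hdk := Nat.dvd_of_mem_divisors hd
      have hd0 : (d : ℝ) ≠ 0 := by
        exact_mod_cast (Nat.pos_of_mem_divisors hd).ne'
      rw [Nat.cast_div hdk hd0]
      field_simp
    rw [meanWeight, h4, Finset.mul_sum, Finset.sum_mul]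
    refine Finset.sum_congr rfl fun d hd => ?_
    have hd0 : (d : ℝ) ≠ 0 := by
      exact_mod_cast (Nat.pos_of_mem_divisors hd).ne'
    field_simp
  rw [h3]
  exact tendsto_finsetSum _ fun d hd =>
    (tendsto_card_gcd hS (Nat.pos_of_mem_divisors hd)).const_mul _

/-! ### Triangles, trapezoids and the hyperbola -/

/-- The triangle `0 < x ≤ X`, `b₁ x < y < b₂ x`. -/
def triangle (X b₁ b₂ : ℝ) : Set (ℝ × ℝ) :=
  regionBetween (fun x => b₁ * x) (fun x => b₂ * x) (Set.Ioc 0 X)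

theorem isStarRegion_triangle {X b₁ b₂ : ℝ} (hX : X ≤ 1) (hb₁ : 0 ≤ b₁) (hb₂ : b₂ ≤ 1) :
    IsStarRegion (triangle X b₁ b₂) where
  subset := by
    rintro ⟨x, y⟩ ⟨⟨h1, h2⟩, h3, h4⟩
    simp only at h1 h2 h3 h4
    refine ⟨⟨h1, h2.trans hX⟩, ?_, ?_⟩
    · exact (mul_nonneg hb₁ h1.le).trans_lt h3
    · simp only; nlinarith
  measurable := measurableSet_regionBetween (by fun_prop) (by fun_prop) measurableSet_Ioc
  frontier_null := by
    refine Convex.addHaar_frontier _ ?_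
    rintro ⟨x, y⟩ ⟨⟨h1, h2⟩, h3, h4⟩ ⟨x', y'⟩ ⟨⟨h1', h2'⟩, h3', h4'⟩ a b ha hb hab
    simp only at h1 h2 h3 h4 h1' h2' h3' h4'
    have key : ∀ {s t : ℝ}, 0 < s → 0 < t → 0 < a * s + b * t := by
      intro s t hs ht
      rcases ha.eq_or_lt with rfl | ha
      · have : b = 1 := by linarith
        subst this; linarith
      · have := mul_pos ha hs
        have := mul_nonneg hb ht.le
        linarith
    have hb' : b = 1 - a := by linarith
    refine ⟨⟨?_, ?_⟩, ?_, ?_⟩ <;> simp only [Prod.smul_mk, Prod.mk_add_mk, smul_eq_mul]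
    · exact key h1 h1'
    · nlinarith
    · have := key (sub_pos.2 h3) (sub_pos.2 h3')
      linarith
    · have := key (sub_pos.2 h4) (sub_pos.2 h4')
      linarith
  star := by
    rintro ⟨x, y⟩ ⟨⟨h1, h2⟩, h3, h4⟩ t ht ht1
    simp only at h1 h2 h3 h4
    refine ⟨⟨mul_pos ht h1, ?_⟩, ?_, ?_⟩ <;> simp only
    · nlinarith
    · have := mul_lt_mul_of_pos_left h3 ht
      linarith
    · have := mul_lt_mul_of_pos_left h4 ht
      linarith

theorem volume_triangle {X b₁ b₂ : ℝ} (hX : 0 ≤ X) (hb : b₁ ≤ b₂) :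
    volume.real (triangle X b₁ b₂) = (b₂ - b₁) * X ^ 2 / 2 := by
  have hint : ∀ b : ℝ, IntegrableOn (fun x : ℝ => b * x) (Set.Ioc 0 X) :=
    fun b => (Continuous.integrableOn_Ioc (by fun_prop))
  rw [triangle, measureReal_def, Measure.volume_eq_prod,
    volume_regionBetween_eq_integral (hint b₁) (hint b₂) measurableSet_Ioc
      (fun x hx => mul_le_mul_of_nonneg_right hb hx.1.le),
    ← intervalIntegral.integral_of_le hX]
  have : ∫ x in (0 : ℝ)..X, ((fun x => b₂ * x) - fun x => b₁ * x) x =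
      (b₂ - b₁) * X ^ 2 / 2 := by
    simp only [Pi.sub_apply, ← sub_mul]
    rw [intervalIntegral.integral_const_mul, integral_id]
    ring
  rw [this, ENNReal.toReal_ofReal]
  have := sub_nonneg.2 hb
  positivity

/-- The trapezoid `X₁ < x ≤ X₂`, `b₁ x < y < b₂ x`. -/
def trapezoid (X₁ X₂ b₁ b₂ : ℝ) : Set (ℝ × ℝ) :=
  regionBetween (fun x => b₁ * x) (fun x => b₂ * x) (Set.Ioc X₁ X₂)

/-- A trapezoid away from the origin is not star-shaped, but it is the difference of two triangles
that are. -/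
theorem tendsto_sum_gcdWeight_trapezoid {X₁ X₂ b₁ b₂ : ℝ} (h1 : 0 ≤ X₁) (h12 : X₁ ≤ X₂)
    (h2 : X₂ ≤ 1) (hb₁ : 0 ≤ b₁) (hb : b₁ ≤ b₂) (hb₂ : b₂ ≤ 1) {k : ℕ} (hk : 0 < k) :
    Tendsto (fun Q : ℕ => (∑ v ∈ latticePoints (trapezoid X₁ X₂ b₁ b₂) Q, (gcdWeight k v : ℝ)) /
      (Q : ℝ) ^ 2) atTop (𝓝 (meanWeight k * ((b₂ - b₁) * (X₂ ^ 2 - X₁ ^ 2) / 2))) := by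
  have hA := tendsto_sum_gcdWeight (isStarRegion_triangle h2 hb₁ hb₂) hk
  have hB := tendsto_sum_gcdWeight (isStarRegion_triangle (h12.trans h2) hb₁ hb₂) hk
  rw [volume_triangle (h1.trans h12) hb] at hA
  rw [volume_triangle h1 hb] at hB
  have h := hA.sub hB
  have hlim : meanWeight k * ((b₂ - b₁) * X₂ ^ 2 / 2) - meanWeight k * ((b₂ - b₁) * X₁ ^ 2 / 2) =
      meanWeight k * ((b₂ - b₁) * (X₂ ^ 2 - X₁ ^ 2) / 2) := by ring
  rw [hlim] at h
  refine h.congr fun Q => ?_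
  rw [← sub_div]
  congr 1
  have hunion : latticePoints (triangle X₂ b₁ b₂) Q =
      latticePoints (triangle X₁ b₁ b₂) Q ∪ latticePoints (trapezoid X₁ X₂ b₁ b₂) Q := by
    ext v
    simp only [Finset.mem_union, mem_latticePoints, ← and_or_left, and_congr_right_iff]
    rintro ⟨⟨hv, hvQ⟩, _⟩
    have : (0 : ℝ) < (v.1 : ℝ) / Q :=
      div_pos (by exact_mod_cast hv) (by exact_mod_cast (hv.trans hvQ))
    simp only [triangle, trapezoid, regionBetween, Set.mem_ofPred_eq, Set.mem_Ioc, Set.mem_Ioo]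
    grind
  have hdisj : Disjoint (latticePoints (triangle X₁ b₁ b₂) Q)
      (latticePoints (trapezoid X₁ X₂ b₁ b₂) Q) := by
    rw [Finset.disjoint_left]
    intro v hv hv'
    rw [mem_latticePoints] at hv hv'
    exact absurd hv.2.1.2 (not_le.2 hv'.2.1.1)
  rw [hunion, Finset.sum_union hdisj]
  ring

/-- The area `1 - c + c log c` of the part `x y ≥ c` of the unit square. -/
def hyperbolaArea (c : ℝ) : ℝ := 1 - c + c * Real.log c

/-- The part `x y < c` of the half-open unit square. -/
def underHyperbola (c : ℝ) : Set (ℝ × ℝ) :=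
  regionBetween (fun _ => 0) (fun x => min 1 (c / x)) (Set.Ioc 0 1)

/-- Serves to show that the hyperbola is a null set, since convex sets have null frontier. The cross
term satisfies xy' + x'y ≥ c(x/x' + x'/x) ≥ 2c. -/
theorem convex_aboveHyperbola {c : ℝ} (hc : 0 < c) :
    Convex ℝ {p : ℝ × ℝ | 0 < p.1 ∧ c ≤ p.1 * p.2} := by
  rintro ⟨x, y⟩ ⟨h1, h2⟩ ⟨x', y'⟩ ⟨h1', h2'⟩ a b ha hb hab
  simp only at h1 h2 h1' h2'
  have hcross : 2 * c ≤ x * y' + x' * y := by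
    have e1 : c / x ≤ y := by rw [div_le_iff₀ h1]; linarith
    have e2 : c / x' ≤ y' := by rw [div_le_iff₀ h1']; linarith
    have e3 : 2 * c ≤ x * (c / x') + x' * (c / x) := by
      rw [← sub_nonneg]
      have : x * (c / x') + x' * (c / x) - 2 * c = c * (x - x') ^ 2 / (x * x') := by
        field_simp; ring
      rw [this]; positivity
    nlinarith
  refine ⟨?_, ?_⟩ <;> simp only [Prod.smul_mk, Prod.mk_add_mk, smul_eq_mul]
  · rcases ha.eq_or_lt with rfl | ha
    · have : b = 1 := by linarith
      subst this; linarith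
    · have := mul_pos ha h1
      have := mul_nonneg hb h1'.le
      linarith
  · have e1 : c = a ^ 2 * c + b ^ 2 * c + a * b * (2 * c) := by
      have : b = 1 - a := by linarith
      subst this; ring
    have := mul_nonneg ha hb
    nlinarith [mul_le_mul_of_nonneg_left h2 (sq_nonneg a),
      mul_le_mul_of_nonneg_left h2' (sq_nonneg b), mul_le_mul_of_nonneg_left hcross this]

theorem isStarRegion_underHyperbola {c : ℝ} (hc : 0 < c) : IsStarRegion (underHyperbola c) where
  subset := by
    rintro ⟨x, y⟩ ⟨h1, h3, h4⟩
    exact ⟨h1, h3, (h4.le.trans (min_le_left _ _))⟩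
  measurable := measurableSet_regionBetween (by fun_prop) (by fun_prop) measurableSet_Ioc
  frontier_null := by
    have heq : underHyperbola c =
        (Set.Ioc 0 1 ×ˢ Set.Ioo 0 1) ∩ {p : ℝ × ℝ | 0 < p.1 ∧ c ≤ p.1 * p.2}ᶜ := by
      ext ⟨x, y⟩
      simp only [underHyperbola, regionBetween, Set.mem_ofPred_eq, Set.mem_Ioc, Set.mem_Ioo,
        lt_min_iff, Set.mem_inter_iff, Set.mem_prod, Set.mem_compl_iff, not_and, not_le]
      constructor
      · rintro ⟨⟨h1, h2⟩, h3, h4, h5⟩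
        refine ⟨⟨⟨h1, h2⟩, h3, h4⟩, fun _ => ?_⟩
        rw [lt_div_iff₀ h1] at h5
        linarith
      · rintro ⟨⟨⟨h1, h2⟩, h3, h4⟩, h5⟩
        refine ⟨⟨h1, h2⟩, h3, h4, ?_⟩
        rw [lt_div_iff₀ h1]
        linarith [h5 h1]
    rw [heq]
    refine measure_mono_null (frontier_inter_subset _ _) ?_
    refine measure_union_null (measure_mono_null Set.inter_subset_left ?_)
      (measure_mono_null Set.inter_subset_right ?_)
    · exact ((convex_Ioc _ _).prod (convex_Ioo _ _)).addHaar_frontier _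
    · rw [frontier_compl]
      exact (convex_aboveHyperbola hc).addHaar_frontier _
  star := by
    rintro ⟨x, y⟩ ⟨⟨h1, h2⟩, h3, h4⟩ t ht ht1
    simp only [lt_min_iff] at h1 h2 h3 h4
    refine ⟨⟨mul_pos ht h1, ?_⟩, mul_pos ht h3, ?_⟩ <;> simp only
    · nlinarith
    · have h5 := h4.2
      rw [lt_div_iff₀ h1] at h5
      rw [lt_min_iff, lt_div_iff₀ (mul_pos ht h1)]
      refine ⟨by nlinarith [h4.1], ?_⟩
      have : t * y * (t * x) = (t * t) * (y * x) := by ring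
      rw [this]
      have : t * t ≤ 1 := by nlinarith
      have : 0 < y * x := mul_pos h3 h1
      nlinarith

theorem volume_underHyperbola {c : ℝ} (hc : 0 < c) (hc1 : c ≤ 1) :
    volume.real (underHyperbola c) = 1 - hyperbolaArea c := by
  have hcont : ContinuousOn (fun x : ℝ => min 1 (c / x)) (Set.Icc c 1) :=
    fun x hx => Tendsto.min tendsto_const_nhds
      ((continuousOn_const.div continuousOn_id fun x hx => (hc.trans_le hx.1).ne') x hx)
  have hI1 : IntervalIntegrable (fun x : ℝ => min 1 (c / x)) volume 0 c :=
    (intervalIntegrable_const (c := (1 : ℝ))).congr fun x hx => by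
      rw [Set.uIoc_of_le hc.le] at hx
      exact (min_eq_left ((one_le_div hx.1).2 hx.2)).symm
  have hI2 : IntervalIntegrable (fun x : ℝ => min 1 (c / x)) volume c 1 :=
    ContinuousOn.intervalIntegrable_of_Icc hc1 hcont
  have hI := hI1.trans hI2
  have e1 : ∫ x in (0 : ℝ)..c, min 1 (c / x) = c := by
    rw [intervalIntegral.integral_congr_ae (g := fun _ => (1 : ℝ))]
    · simp
    · refine Eventually.of_forall fun x hx => ?_
      rw [Set.uIoc_of_le hc.le] at hx
      exact min_eq_left ((one_le_div hx.1).2 hx.2)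
  have e2 : ∫ x in c..1, min 1 (c / x) = - (c * Real.log c) := by
    rw [intervalIntegral.integral_congr (g := fun x => c * x⁻¹)]
    · rw [intervalIntegral.integral_const_mul, integral_inv_of_pos hc one_pos]
      simp
    · intro x hx
      rw [Set.uIcc_of_le hc1] at hx
      simp only
      rw [min_eq_right ((div_le_one (hc.trans_le hx.1)).2 hx.1), div_eq_mul_inv]
  rw [underHyperbola, measureReal_def, Measure.volume_eq_prod,
    volume_regionBetween_eq_integral integrableOn_zero
      ((intervalIntegrable_iff_integrableOn_Ioc_of_le zero_le_one).1 hI) measurableSet_Ioc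
      (fun x hx => le_min zero_le_one (div_nonneg hc.le hx.1.le)),
    ← intervalIntegral.integral_of_le zero_le_one]
  have : ∫ x in (0 : ℝ)..1, ((fun x : ℝ => min 1 (c / x)) - fun _ : ℝ => (0 : ℝ)) x = 1 - hyperbolaArea c := by
    simp only [Pi.sub_apply, sub_zero]
    rw [← intervalIntegral.integral_add_adjacent_intervals hI1 hI2, e1, e2, hyperbolaArea]
    ring
  rw [this, ENNReal.toReal_ofReal]
  rw [hyperbolaArea]
  have := mul_nonneg hc.le (neg_nonneg.2 (Real.log_nonpos hc.le hc1))
  linarith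

theorem isStarRegion_square : IsStarRegion (Set.Ioc 0 1 ×ˢ Set.Ioc 0 1) where
  subset := subset_rfl
  measurable := measurableSet_Ioc.prod measurableSet_Ioc
  frontier_null := ((convex_Ioc _ _).prod (convex_Ioc _ _)).addHaar_frontier _
  star := by
    rintro ⟨x, y⟩ ⟨⟨h1, h2⟩, h3, h4⟩ t ht ht1
    simp only at h1 h2 h3 h4
    exact ⟨⟨mul_pos ht h1, by simp only; nlinarith⟩, mul_pos ht h3, by simp only; nlinarith⟩

/-- Sums of `gcdWeight k` over the lattice points of `[1, Q]²` above the hyperbola `x y = c Q²`. -/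
theorem eventually_sum_gcdWeight_hyperbola_le {c : ℝ} (hc : 0 < c) (hc1 : c ≤ 1) {k : ℕ}
    (hk : 0 < k) {ε : ℝ} (hε : 0 < ε) :
    ∀ᶠ Q : ℕ in atTop,
      ∑ v ∈ (Finset.Icc 1 Q ×ˢ Finset.Icc 1 Q).filter
        (fun v => c * (Q : ℝ) ^ 2 ≤ (v.1 : ℝ) * v.2), (gcdWeight k v : ℝ) ≤
      (meanWeight k * hyperbolaArea c + ε) * (Q : ℝ) ^ 2 := by
  -- The region above the hyperbola is not star-shaped; its sum is bounded by that of the square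
  -- minus that of the star-shaped part below.
  have hA := tendsto_sum_gcdWeight isStarRegion_square hk
  have hB := tendsto_sum_gcdWeight (isStarRegion_underHyperbola hc) hk
  have hsq : volume.real (Set.Ioc (0 : ℝ) 1 ×ˢ Set.Ioc (0 : ℝ) 1) = 1 := by
    rw [Measure.volume_eq_prod, measureReal_prod_prod]
    simp
  rw [hsq] at hA
  rw [volume_underHyperbola hc hc1] at hB
  have h := hA.sub hB
  have hlt : meanWeight k * 1 - meanWeight k * (1 - hyperbolaArea c) <
      meanWeight k * hyperbolaArea c + ε := by linarith
  filter_upwards [h.eventually_lt_const hlt, eventually_gt_atTop 0] with Q hQ hQ0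
  have hQ' : (0 : ℝ) < Q := by exact_mod_cast hQ0
  rw [← sub_div, div_lt_iff₀ (by positivity)] at hQ
  refine le_trans ?_ hQ.le
  rw [le_sub_iff_add_le, ← Finset.sum_union]
  · refine Finset.sum_le_sum_of_subset_of_nonneg ?_ fun _ _ _ => Nat.cast_nonneg _
    intro v hv
    rw [Finset.mem_union, Finset.mem_filter, mem_latticePoints, Finset.mem_product,
      Finset.mem_Icc, Finset.mem_Icc] at hv
    rw [mem_latticePoints]
    have hv' : (1 ≤ v.1 ∧ v.1 ≤ Q) ∧ (1 ≤ v.2 ∧ v.2 ≤ Q) := by tauto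
    refine ⟨hv', ⟨⟨?_, ?_⟩, ?_, ?_⟩⟩
    · exact div_pos (by exact_mod_cast hv'.1.1) hQ'
    · exact (div_le_one hQ').2 (by exact_mod_cast hv'.1.2)
    · exact div_pos (by exact_mod_cast hv'.2.1) hQ'
    · exact (div_le_one hQ').2 (by exact_mod_cast hv'.2.2)
  · rw [Finset.disjoint_left]
    intro v hv hv'
    rw [Finset.mem_filter] at hv
    rw [mem_latticePoints] at hv'
    obtain ⟨⟨h1, _⟩, _, h2⟩ := hv'.2
    simp only [lt_min_iff] at h1 h2
    have h3 := h2.2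
    rw [lt_div_iff₀ h1] at h3
    have h4 : (v.2 : ℝ) / Q * ((v.1 : ℝ) / Q) = (v.1 * v.2 : ℝ) / (Q : ℝ) ^ 2 := by
      field_simp
    rw [h4, div_lt_iff₀ (by positivity)] at h3
    linarith [hv.2]

/-! ### Pairs of given determinant: the upper bound -/

open scoped Classical in
/-- The pairs of entries `p / q`, `p' / q'` of `M(Q)` in `I` with `p q' - p' q = k` and
`q q' ≥ B`. -/
def detPairs (I : Set ℝ) (Q k : ℕ) (B : ℝ) : Finset ((ℕ × ℕ) × (ℕ × ℕ)) :=
  (indices Q ×ˢ indices Q).filter fun ij =>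
    point ij.1 ∈ I ∧ point ij.2 ∈ I ∧ ij.1.1 * ij.2.2 = ij.2.1 * ij.1.2 + k ∧
      B ≤ (ij.1.2 : ℝ) * ij.2.2

theorem mem_indices {Q : ℕ} {i : ℕ × ℕ} : i ∈ indices Q ↔ 1 ≤ i.1 ∧ i.1 < i.2 ∧ i.2 ≤ Q := by
  simp only [indices, Finset.mem_filter, Finset.mem_product, Finset.mem_Icc]
  omega

theorem mem_detPairs {I : Set ℝ} {Q k : ℕ} {B : ℝ} {ij : (ℕ × ℕ) × (ℕ × ℕ)} :
    ij ∈ detPairs I Q k B ↔ (ij.1 ∈ indices Q ∧ ij.2 ∈ indices Q) ∧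
      point ij.1 ∈ I ∧ point ij.2 ∈ I ∧ ij.1.1 * ij.2.2 = ij.2.1 * ij.1.2 + k ∧
      B ≤ (ij.1.2 : ℝ) * ij.2.2 := by
  simp [detPairs]

theorem modEq_of_mul_eq_mul_add {q q' k p p' r r' : ℕ} (hq : 0 < q)
    (h : p * q' = p' * q + k) (h' : r * q' = r' * q + k) :
    p ≡ r [MOD q / Nat.gcd q q'] := by
  have h1 : p * q' ≡ r * q' [MOD q] := by
    rw [h, h']
    exact Nat.ModEq.add_right k
      ((Nat.modEq_zero_iff_dvd.2 (dvd_mul_left _ _)).trans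
        (Nat.modEq_zero_iff_dvd.2 (dvd_mul_left _ _)).symm)
  exact Nat.ModEq.cancel_right_div_gcd hq h1

/-- With q and q' fixed, p is determined modulo q / gcd(q, q'), so 0 < p < q leaves at most gcd(q,
q') choices, and p determines p'. A single solution already forces gcd(q, q') ∣ k. -/
theorem card_detPairs_fiber_le (I : Set ℝ) (Q k : ℕ) (B : ℝ) (v : ℕ × ℕ) :
    ((detPairs I Q k B).filter fun ij => (ij.1.2, ij.2.2) = v).card ≤ gcdWeight k v := by
  obtain ⟨q, q'⟩ := v
  set F := (detPairs I Q k B).filter fun ij => (ij.1.2, ij.2.2) = (q, q') with hF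
  have hmem : ∀ ij ∈ F, ij.1.1 * q' = ij.2.1 * q + k ∧ ij.1.1 < q ∧ ij.1.2 = q ∧ ij.2.2 = q' := by
    intro ij hij
    rw [hF, Finset.mem_filter, mem_detPairs, mem_indices, Prod.mk.injEq] at hij
    obtain ⟨⟨⟨h1, _⟩, _, _, h2, _⟩, rfl, rfl⟩ := hij
    exact ⟨h2, h1.2.1, rfl, rfl⟩
  rcases F.eq_empty_or_nonempty with h0 | ⟨ij₀, h₀⟩
  · simp [h0]
  obtain ⟨e₀, l₀, _⟩ := hmem ij₀ h₀
  have hq : 0 < q := by omega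
  have hg : Nat.gcd q q' ∣ k :=
    (Nat.dvd_add_right ((Nat.gcd_dvd_left q q').mul_left _)).1
      (e₀ ▸ (Nat.gcd_dvd_right q q').mul_left _)
  have hgpos : 0 < Nat.gcd q q' := Nat.gcd_pos_of_pos_left _ hq
  have hdiv : q / Nat.gcd q q' * Nat.gcd q q' = q := Nat.div_mul_cancel (Nat.gcd_dvd_left q q')
  rw [gcdWeight, if_pos hg, ← Finset.card_range (Nat.gcd q q')]
  refine Finset.card_le_card_of_injOn (fun ij => ij.1.1 / (q / Nat.gcd q q')) ?_ ?_
  · intro ij hij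
    obtain ⟨_, h2, _⟩ := hmem ij hij
    simp only [Finset.coe_range, Set.mem_Iio]
    refine Nat.div_lt_of_lt_mul ?_
    rwa [hdiv]
  · intro ij hij ij' hij' heq
    obtain ⟨h1, _, h3, h4⟩ := hmem ij hij
    obtain ⟨h1', _, h3', h4'⟩ := hmem ij' hij'
    have hp : ij.1.1 = ij'.1.1 := by
      have hm : ij.1.1 % (q / Nat.gcd q q') = ij'.1.1 % (q / Nat.gcd q q') :=
        modEq_of_mul_eq_mul_add hq h1 h1'
      rw [← Nat.div_add_mod ij.1.1 (q / Nat.gcd q q'),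
        ← Nat.div_add_mod ij'.1.1 (q / Nat.gcd q q'), hm]
      simp only at heq
      rw [heq]
    have hp' : ij.2.1 = ij'.2.1 := by
      rw [hp] at h1
      exact Nat.eq_of_mul_eq_mul_right hq (by omega)
    exact Prod.ext (Prod.ext hp (h3.trans h3'.symm)) (Prod.ext hp' (h4.trans h4'.symm))

theorem card_detPairs_le (I : Set ℝ) (Q k : ℕ) (B : ℝ) :
    (detPairs I Q k B).card ≤
      ∑ v ∈ (Finset.Icc 1 Q ×ˢ Finset.Icc 1 Q).filter
        (fun v => B ≤ (v.1 : ℝ) * v.2), gcdWeight k v := by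
  rw [Finset.card_eq_sum_card_fiberwise (f := fun ij => (ij.1.2, ij.2.2))
    (t := (Finset.Icc 1 Q ×ˢ Finset.Icc 1 Q).filter (fun v : ℕ × ℕ => B ≤ (v.1 : ℝ) * v.2))]
  · exact Finset.sum_le_sum fun v _ => card_detPairs_fiber_le I Q k B v
  · intro ij hij
    rw [Finset.mem_coe, mem_detPairs, mem_indices, mem_indices] at hij
    simp only [Finset.coe_filter, Finset.mem_product, Finset.mem_Icc, Set.mem_ofPred_eq]
    refine ⟨?_, hij.2.2.2.2⟩
    omega

/-! ### The lower bound in a narrow sector of slopes -/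

/-- Integral `2 × 2` matrices of determinant `k` with prescribed image of a primitive vector. -/
theorem exists_matrix_of_gcd_dvd {m n D a k : ℤ} (hmn : IsCoprime m n)
    (hg : (Int.gcd D a : ℤ) ∣ k) :
    ∃ p q p' q' : ℤ, q' * m - q * n = D ∧ p' * m - p * n = a ∧ p * q' - p' * q = k := by
  obtain ⟨x, y, hxy⟩ := hmn
  obtain ⟨l, hl⟩ := hg
  have hb := Int.gcd_eq_gcd_ab D a
  -- As xm + yn = 1, the first two equations are solved by (q', q) = D(x, -y) + s(n, m) and (p', p)
  -- = a(x, -y) + r(n, m). The determinant is then rD - sa, and Bézout coefficients scaled by l make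
  -- it k.
  refine ⟨a * (-y) + (l * Int.gcdA D a) * m, D * (-y) + (-(l * Int.gcdB D a)) * m,
    a * x + (l * Int.gcdA D a) * n, D * x + (-(l * Int.gcdB D a)) * n, ?_, ?_, ?_⟩
  · linear_combination D * hxy
  · linear_combination a * hxy
  · rw [hl, hb]
    linear_combination (D * (l * Int.gcdA D a) + a * (l * Int.gcdB D a)) * hxy

theorem sub_one_le_card_Icc (x y : ℝ) : y - x - 1 ≤ ((Finset.Icc ⌈x⌉ ⌊y⌋).card : ℝ) := by
  rw [Int.card_Icc]
  have h1 := Int.ceil_lt_add_one x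
  have h2 := Int.lt_floor_add_one y
  have h3 : ((⌊y⌋ + 1 - ⌈x⌉ : ℤ) : ℝ) ≤ (((⌊y⌋ + 1 - ⌈x⌉).toNat : ℤ) : ℝ) :=
    Int.cast_le.2 (Int.self_le_toNat _)
  push_cast at h3 ⊢
  linarith

/-- For given `D` and `a`, the solutions of `q' m - q n = D`, `p' m - p n = a`, `p q' - p' q = k`
form an arithmetic progression along which `q` has step `m D / gcd D a`. -/
theorem exists_many_matrices {m n k D a : ℕ} (hm : 0 < m) (hn : 0 < n) (hmn : Nat.Coprime m n)
    (hD : 0 < D) (ha : 0 < a) (hg : Nat.gcd D a ∣ k) {x y : ℝ} (hx : 0 < x) :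
    ∃ F : Finset ((ℕ × ℕ) × (ℕ × ℕ)),
      (y - x) / (m * D) * Nat.gcd D a - 1 ≤ (F.card : ℝ) ∧
      ∀ ij ∈ F, 0 < ij.1.1 ∧ 0 < ij.1.2 ∧ 0 < ij.2.1 ∧ 0 < ij.2.2 ∧
        ij.2.2 * m = ij.1.2 * n + D ∧ ij.2.1 * m = ij.1.1 * n + a ∧
        ij.1.1 * ij.2.2 = ij.2.1 * ij.1.2 + k ∧ x ≤ (ij.1.2 : ℝ) ∧ (ij.1.2 : ℝ) ≤ y := by
  obtain ⟨p, q, p', q', e1, e2, e3⟩ := exists_matrix_of_gcd_dvd (m := m) (n := n) (D := D) (a := a)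
    (k := k) (Nat.isCoprime_iff_coprime.2 hmn) (by rw [Int.gcd_natCast_natCast]; exact_mod_cast hg)
  have hgpos : 0 < Nat.gcd D a := Nat.gcd_pos_of_pos_left _ hD
  obtain ⟨D₁, hD₁⟩ := Nat.gcd_dvd_left D a
  obtain ⟨a₁, ha₁⟩ := Nat.gcd_dvd_right D a
  set g := Nat.gcd D a
  have hD₁pos : 0 < D₁ := by
    rcases Nat.eq_zero_or_pos D₁ with h | h
    · subst h; omega
    · exact h
  have hmR : (0 : ℝ) < m := by exact_mod_cast hm
  have hgR : (0 : ℝ) < g := by exact_mod_cast hgpos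
  have hD₁R : (0 : ℝ) < D₁ := by exact_mod_cast hD₁pos
  have hDR : (D : ℝ) = g * D₁ := by exact_mod_cast hD₁
  have hDZ : (D : ℤ) = g * D₁ := by exact_mod_cast hD₁
  have haZ : (a : ℤ) = g * a₁ := by exact_mod_cast ha₁
  have hgZ : (g : ℤ) ≠ 0 := by exact_mod_cast hgpos.ne'
  have hmZ : (0 : ℤ) < m := by exact_mod_cast hm
  have hnZ : (0 : ℤ) < n := by exact_mod_cast hn
  have hDpZ : (0 : ℤ) < D := by exact_mod_cast hD
  have hapZ : (0 : ℤ) < a := by exact_mod_cast ha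
  set lo : ℝ := (x - q) / (m * D₁) with hlo
  set hi : ℝ := (y - q) / (m * D₁) with hhi
  have key : ∀ t ∈ Finset.Icc ⌈lo⌉ ⌊hi⌋, ∃ P R P' R' : ℕ,
      (P : ℤ) = p + t * (a₁ * m) ∧ (R : ℤ) = q + t * (D₁ * m) ∧
      (P' : ℤ) = p' + t * (a₁ * n) ∧ (R' : ℤ) = q' + t * (D₁ * n) ∧
      0 < P ∧ 0 < R ∧ 0 < P' ∧ 0 < R' ∧ R' * m = R * n + D ∧ P' * m = P * n + a ∧
        P * R' = P' * R + k ∧ x ≤ (R : ℝ) ∧ (R : ℝ) ≤ y := by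
    intro t ht
    rw [Finset.mem_Icc, Int.ceil_le, Int.le_floor, hlo, hhi, div_le_iff₀ (by positivity),
      le_div_iff₀ (by positivity)] at ht
    obtain ⟨ht1, ht2⟩ := ht
    obtain ⟨P, hP⟩ : ∃ P, P = p + t * (a₁ * m) := ⟨_, rfl⟩
    obtain ⟨R, hR⟩ : ∃ R, R = q + t * (D₁ * m) := ⟨_, rfl⟩
    obtain ⟨P', hP'⟩ : ∃ P', P' = p' + t * (a₁ * n) := ⟨_, rfl⟩
    obtain ⟨R', hR'⟩ : ∃ R', R' = q' + t * (D₁ * n) := ⟨_, rfl⟩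
    have f1 : R' * m - R * n = D := by rw [hR, hR', ← e1]; ring
    have f2 : P' * m - P * n = a := by rw [hP, hP', ← e2]; ring
    have f3 : P * R' - P' * R = k := by
      rw [← e3, hP, hP', hR, hR']
      have h0 : t * (a₁ * (m * q' - n * q) - D₁ * (p' * m - p * n)) = 0 := by
        have h1 : (a₁ : ℤ) * (m * q' - n * q) - D₁ * (p' * m - p * n) = a₁ * D - D₁ * a := by
          rw [← e1, ← e2]; ring
        rw [h1, hDZ, haZ]; ring
      linear_combination h0
    have hRR : (R : ℝ) = q + t * (m * D₁) := by rw [hR]; push_cast; ring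
    have hRx : x ≤ (R : ℝ) := by rw [hRR]; linarith
    have hRy : (R : ℝ) ≤ y := by rw [hRR]; linarith
    -- Positivity propagates from q ≥ x > 0 through q'm = qn + D, then pD = aq + km, then p'm = pn +
    -- a.
    have hRpos : 0 < R := by exact_mod_cast hx.trans_le hRx
    have hR'pos : 0 < R' := by
      have : 0 < R' * m := by
        have := mul_pos hRpos hnZ
        linarith
      exact pos_of_mul_pos_left this hmZ.le
    have hPpos : 0 < P := by
      have h1 : P * D = a * R + k * m := by linear_combination (-P) * f1 + R * f2 + m * f3
      have h2 : 0 < P * D := by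
        rw [h1]
        have := mul_pos hapZ hRpos
        have : (0 : ℤ) ≤ k * m := by positivity
        linarith
      exact pos_of_mul_pos_left h2 hDpZ.le
    have hP'pos : 0 < P' := by
      have : 0 < P' * m := by
        have := mul_pos hPpos hnZ
        linarith
      exact pos_of_mul_pos_left this hmZ.le
    lift P to ℕ using hPpos.le
    lift P' to ℕ using hP'pos.le
    lift R to ℕ using hRpos.le
    lift R' to ℕ using hR'pos.le
    refine ⟨P, R, P', R', hP, hR, hP', hR', by exact_mod_cast hPpos, by exact_mod_cast hRpos,
      by exact_mod_cast hP'pos, by exact_mod_cast hR'pos, ?_, ?_, ?_, by exact_mod_cast hRx,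
      by exact_mod_cast hRy⟩
    · have : (R' : ℤ) * m = R * n + D := by linarith
      exact_mod_cast this
    · have : (P' : ℤ) * m = P * n + a := by linarith
      exact_mod_cast this
    · have : (P : ℤ) * R' = P' * R + k := by linarith
      exact_mod_cast this
  choose! P R P' R' hP hR hP' hR' hrest using key
  refine ⟨(Finset.Icc ⌈lo⌉ ⌊hi⌋).image fun t => ((P t, R t), (P' t, R' t)), ?_, ?_⟩
  · rw [Finset.card_image_of_injOn]
    · refine le_trans (le_of_eq ?_) (sub_one_le_card_Icc lo hi)
      rw [hlo, hhi, hDR]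
      field_simp
      ring
    · intro s hs t ht hst
      have h1 : R s = R t := congrArg (fun ij => ij.1.2) hst
      have h2 := hR s hs
      rw [h1, hR t ht] at h2
      have h3 : (D₁ : ℤ) * m ≠ 0 := by positivity
      exact (mul_right_cancel₀ h3 (by linarith)).symm
  · intro ij hij
    obtain ⟨t, ht, rfl⟩ := Finset.mem_image.1 hij
    exact hrest t ht

/-- The elements of `detPairs I Q k B` whose denominators have ratio `q' / q` in `[x, y]`. -/
def sectorPairs (I : Set ℝ) (Q k : ℕ) (B x y : ℝ) : Finset ((ℕ × ℕ) × (ℕ × ℕ)) :=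
  (detPairs I Q k B).filter fun ij =>
    x * (ij.1.2 : ℝ) ≤ ij.2.2 ∧ (ij.2.2 : ℝ) ≤ y * ij.1.2

/-- Since q'/q = n/m + D/(mq), the slope window amounts to mD/θ₂ ≤ q ≤ mD/θ₁. The bounds on D then
give ρ₁Q ≤ q ≤ ρ₂Q, hence q, q' ≤ Q and qq' ≥ cQ². Both fractions exceed a/D by the small amounts
km/(qD) and kn/(q'D), which the gap b₃ - b₂ absorbs. -/
theorem mem_sectorPairs_of_matrix {I : Set ℝ} {Q k m n D a : ℕ} {θ₁ θ₂ ρ₁ ρ₂ b₁ b₂ b₃ c : ℝ}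
    (hm : 0 < m) (hθ₁ : 0 < θ₁) (hθ : θ₁ < θ₂) (hρ₁ : 0 < ρ₁)
    (hρ₂ : ρ₂ ≤ 1) (hαρ : (n / m + θ₂ / m ^ 2) * ρ₂ ≤ 1) (hc : c ≤ (n / m + θ₁ / m ^ 2) * ρ₁ ^ 2)
    (hb₃ : b₃ ≤ 1) (hI : Set.Ioo b₁ b₃ ⊆ I)
    (hD₁ : θ₂ * ρ₁ / m * Q < D) (hD₂ : (D : ℝ) ≤ θ₁ * ρ₂ / m * Q)
    (ha₁ : b₁ * D < a) (ha₂ : a < b₂ * D)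
    (hs₁ : (k : ℝ) * θ₂ < (b₃ - b₂) * D ^ 2) (hs₂ : (k : ℝ) * n * m < (b₃ - b₂) * D ^ 2)
    {p q p' q' : ℕ} (hp : 0 < p) (hq : 0 < q) (hp' : 0 < p') (hq' : 0 < q')
    (e1 : q' * m = q * n + D) (e2 : p' * m = p * n + a) (e3 : p * q' = p' * q + k)
    (hq₁ : m * D / θ₂ ≤ (q : ℝ)) (hq₂ : (q : ℝ) ≤ m * D / θ₁) :
    ((p, q), (p', q')) ∈ sectorPairs I Q k (c * (Q : ℝ) ^ 2) (n / m + θ₁ / m ^ 2)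
      (n / m + θ₂ / m ^ 2) := by
  have hθ₂ : 0 < θ₂ := hθ₁.trans hθ
  have hm' : (0 : ℝ) < m := by exact_mod_cast hm
  have hp0 : (0 : ℝ) < p := by exact_mod_cast hp
  have hq0 : (0 : ℝ) < q := by exact_mod_cast hq
  have hp0' : (0 : ℝ) < p' := by exact_mod_cast hp'
  have hq0' : (0 : ℝ) < q' := by exact_mod_cast hq'
  have E1 : (q' : ℝ) * m = q * n + D := by exact_mod_cast e1
  have E2 : (p' : ℝ) * m = p * n + a := by exact_mod_cast e2
  have E3 : (p : ℝ) * q' = p' * q + k := by exact_mod_cast e3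
  have hQ0 : (0 : ℝ) ≤ Q := Nat.cast_nonneg Q
  have hD0 : (0 : ℝ) < D := lt_of_le_of_lt (by positivity) hD₁
  rw [div_le_iff₀ hθ₂] at hq₁
  rw [le_div_iff₀ hθ₁] at hq₂
  -- the ratio of the denominators
  have E1' : (q' : ℝ) * m ^ 2 = m * (q * n) + m * D := by linear_combination (m : ℝ) * E1
  have hr₁ : (n / m + θ₁ / m ^ 2) * (q : ℝ) ≤ q' := by
    have h1 : (n / m + θ₁ / m ^ 2) * (q : ℝ) = (m * (q * n) + q * θ₁) / m ^ 2 := by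
      field_simp
    rw [h1, div_le_iff₀ (by positivity)]
    linarith
  have hr₂ : (q' : ℝ) ≤ (n / m + θ₂ / m ^ 2) * q := by
    have h1 : (n / m + θ₂ / m ^ 2) * (q : ℝ) = (m * (q * n) + q * θ₂) / m ^ 2 := by
      field_simp
    rw [h1, le_div_iff₀ (by positivity)]
    linarith
  -- the size of the denominators
  have hqρ₁ : ρ₁ * Q ≤ q := by
    have h1 : θ₂ * ρ₁ / m * Q = (θ₂ * (ρ₁ * Q)) / m := by ring
    rw [h1, div_lt_iff₀ hm'] at hD₁
    have h2 : θ₂ * (ρ₁ * Q) ≤ θ₂ * q := by linarith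
    exact le_of_mul_le_mul_left h2 hθ₂
  have hqρ₂ : (q : ℝ) ≤ ρ₂ * Q := by
    have h1 : θ₁ * ρ₂ / m * Q = (θ₁ * (ρ₂ * Q)) / m := by ring
    rw [h1, le_div_iff₀ hm'] at hD₂
    have h2 : θ₁ * q ≤ θ₁ * (ρ₂ * Q) := by linarith
    exact le_of_mul_le_mul_left h2 hθ₁
  have hα₁ : (0 : ℝ) < n / m + θ₁ / m ^ 2 := by positivity
  have hα₂ : (0 : ℝ) < n / m + θ₂ / m ^ 2 := by positivity
  have hqQ : (q : ℝ) ≤ Q := hqρ₂.trans (mul_le_of_le_one_left hQ0 hρ₂)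
  have hqQ' : (q' : ℝ) ≤ Q := by
    calc (q' : ℝ) ≤ (n / m + θ₂ / m ^ 2) * q := hr₂
      _ ≤ (n / m + θ₂ / m ^ 2) * (ρ₂ * Q) := by gcongr
      _ = ((n / m + θ₂ / m ^ 2) * ρ₂) * Q := by ring
      _ ≤ 1 * Q := by gcongr
      _ = Q := one_mul _
  have hB : c * (Q : ℝ) ^ 2 ≤ (q : ℝ) * q' := by
    calc c * (Q : ℝ) ^ 2 ≤ ((n / m + θ₁ / m ^ 2) * ρ₁ ^ 2) * (Q : ℝ) ^ 2 := by gcongr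
      _ = (n / m + θ₁ / m ^ 2) * ((ρ₁ * Q) * (ρ₁ * Q)) := by ring
      _ ≤ (n / m + θ₁ / m ^ 2) * (q * q) := by gcongr
      _ = q * ((n / m + θ₁ / m ^ 2) * q) := by ring
      _ ≤ q * q' := by gcongr
  -- the fractions
  have F1 : (p : ℝ) * D = a * q + k * m := by linear_combination (-p : ℝ) * E1 + q * E2 + m * E3
  have F2 : (p' : ℝ) * D = a * q' + k * n := by
    linear_combination (-p' : ℝ) * E1 + q' * E2 + n * E3
  have hk0 : (0 : ℝ) ≤ k := Nat.cast_nonneg k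
  have hn0 : (0 : ℝ) ≤ n := Nat.cast_nonneg n
  have hb32 : 0 < b₃ - b₂ := by
    by_contra h
    have : (b₃ - b₂) * (D : ℝ) ^ 2 ≤ 0 := mul_nonpos_of_nonpos_of_nonneg (not_lt.1 h) (by positivity)
    have : (0 : ℝ) ≤ k * θ₂ := by positivity
    linarith
  have G1 : b₁ < (p : ℝ) / q ∧ (p : ℝ) / q < b₃ := by
    have h1 : (p : ℝ) / q = a / D + k * m / (q * D) := by
      field_simp; linarith
    have h2 : b₁ < (a : ℝ) / D := by rwa [lt_div_iff₀ hD0]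
    have h3 : (a : ℝ) / D < b₂ := by rwa [div_lt_iff₀ hD0]
    have h4 : k * m / (q * D) < b₃ - b₂ := by
      rw [div_lt_iff₀ (by positivity)]
      have h5 : (k : ℝ) * m * θ₂ < (b₃ - b₂) * (q * D) * θ₂ := by
        calc (k : ℝ) * m * θ₂ = (k * θ₂) * m := by ring
          _ < ((b₃ - b₂) * D ^ 2) * m := by gcongr
          _ = ((b₃ - b₂) * D) * (m * D) := by ring
          _ ≤ ((b₃ - b₂) * D) * (q * θ₂) := by gcongr
          _ = _ := by ring
      exact lt_of_mul_lt_mul_right h5 hθ₂.le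
    have h5 : (0 : ℝ) ≤ k * m / (q * D) := by positivity
    rw [h1]
    constructor <;> linarith
  have G2 : b₁ < (p' : ℝ) / q' ∧ (p' : ℝ) / q' < b₃ := by
    have h1 : (p' : ℝ) / q' = a / D + k * n / (q' * D) := by
      field_simp; linarith
    have h2 : b₁ < (a : ℝ) / D := by rwa [lt_div_iff₀ hD0]
    have h3 : (a : ℝ) / D < b₂ := by rwa [div_lt_iff₀ hD0]
    have h4 : k * n / (q' * D) < b₃ - b₂ := by
      rw [div_lt_iff₀ (by positivity)]
      have hDq : (D : ℝ) ≤ q' * m := by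
        have : (0 : ℝ) ≤ q * n := by positivity
        linarith
      have h5 : (k : ℝ) * n * m < (b₃ - b₂) * (q' * D) * m := by
        calc (k : ℝ) * n * m < (b₃ - b₂) * D ^ 2 := hs₂
          _ = ((b₃ - b₂) * D) * D := by ring
          _ ≤ ((b₃ - b₂) * D) * (q' * m) := by gcongr
          _ = _ := by ring
      exact lt_of_mul_lt_mul_right h5 hm'.le
    have h5 : (0 : ℝ) ≤ k * n / (q' * D) := by positivity
    rw [h1]
    constructor <;> linarith
  have hlt : ∀ {r s : ℕ}, 0 < s → (r : ℝ) / s < b₃ → r < s := by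
    intro r s hs h
    have h1 := h.trans_le hb₃
    rw [div_lt_one (by exact_mod_cast hs)] at h1
    exact_mod_cast h1
  rw [sectorPairs, Finset.mem_filter, mem_detPairs, mem_indices, mem_indices]
  exact ⟨⟨⟨⟨hp, hlt hq G1.2, by exact_mod_cast hqQ⟩, ⟨hp', hlt hq' G2.2, by exact_mod_cast hqQ'⟩⟩,
    hI G1, hI G2, e3, hB⟩, hr₁, hr₂⟩

/-- The pairs are sorted by (D, a). In each fibre q may range over an interval of length mD(1/θ₁ -
1/θ₂) with step mD / gcd(D, a), so the gcd weight of (D, a) comes back. -/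
theorem sum_gcdWeight_le_card_sectorPairs {I : Set ℝ} {Q k m n : ℕ}
    {θ₁ θ₂ ρ₁ ρ₂ b₁ b₂ b₃ c : ℝ} (hm : 0 < m) (hn : 0 < n) (hmn : Nat.Coprime m n)
    (hθ₁ : 0 < θ₁) (hθ : θ₁ < θ₂) (hρ₁ : 0 < ρ₁)
    (hρ₂ : ρ₂ ≤ 1) (hαρ : (n / m + θ₂ / m ^ 2) * ρ₂ ≤ 1) (hc : c ≤ (n / m + θ₁ / m ^ 2) * ρ₁ ^ 2)
    (hb₂ : b₂ < b₃) (hb₃ : b₃ ≤ 1) (hI : Set.Ioo b₁ b₃ ⊆ I) (hQ : 0 < Q)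
    (hs₁ : (k : ℝ) * θ₂ < (b₃ - b₂) * (θ₂ * ρ₁ / m * Q) ^ 2)
    (hs₂ : (k : ℝ) * n * m < (b₃ - b₂) * (θ₂ * ρ₁ / m * Q) ^ 2) :
    (1 / θ₁ - 1 / θ₂ - 1) *
      ∑ v ∈ latticePoints (trapezoid (θ₂ * ρ₁ / m) (θ₁ * ρ₂ / m) b₁ b₂) Q, (gcdWeight k v : ℝ) ≤
      ((sectorPairs I Q k (c * (Q : ℝ) ^ 2) (n / m + θ₁ / m ^ 2)
        (n / m + θ₂ / m ^ 2)).card : ℝ) := by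
  have hm' : (0 : ℝ) < m := by exact_mod_cast hm
  have hQ' : (0 : ℝ) < Q := by exact_mod_cast hQ
  have hθ₂ : 0 < θ₂ := hθ₁.trans hθ
  set P := sectorPairs I Q k (c * (Q : ℝ) ^ 2) (n / m + θ₁ / m ^ 2) (n / m + θ₂ / m ^ 2) with hP
  -- Truncated subtraction is harmless: fibres of any map are disjoint, and the lifted pairs have
  -- true differences D and a.
  set φ : (ℕ × ℕ) × (ℕ × ℕ) → ℕ × ℕ :=
    fun ij => (ij.2.2 * m - ij.1.2 * n, ij.2.1 * m - ij.1.1 * n) with hφ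
  set V := latticePoints (trapezoid (θ₂ * ρ₁ / m) (θ₁ * ρ₂ / m) b₁ b₂) Q with hV
  have hfib : ∀ v ∈ V, (1 / θ₁ - 1 / θ₂ - 1) * (gcdWeight k v : ℝ) ≤
      ((P.filter fun ij => φ ij = v).card : ℝ) := by
    rintro ⟨D, a⟩ hv
    rw [gcdWeight]
    split_ifs with hg
    swap
    · simp
    rw [hV, mem_latticePoints] at hv
    obtain ⟨⟨⟨hD, hDQ⟩, ha, haQ⟩, ⟨hX₁, hX₂⟩, ha₁, ha₂⟩ := hv
    simp only at hD hDQ ha haQ hX₁ hX₂ ha₁ ha₂ hg ⊢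
    rw [lt_div_iff₀ hQ'] at hX₁
    rw [div_le_iff₀ hQ'] at hX₂
    rw [← mul_div_assoc, div_lt_div_iff_of_pos_right hQ'] at ha₁ ha₂
    have hD' : (0 : ℝ) < D := by exact_mod_cast hD
    have hsq : (θ₂ * ρ₁ / m * Q) ^ 2 ≤ (D : ℝ) ^ 2 := by
      gcongr
    obtain ⟨F, hF, hFm⟩ := exists_many_matrices hm hn hmn hD ha hg (x := m * D / θ₂)
      (y := m * D / θ₁) (by positivity)
    have hsub : F ⊆ P.filter fun ij => φ ij = (D, a) := by
      rintro ⟨⟨p, q⟩, ⟨p', q'⟩⟩ hij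
      obtain ⟨h1, h2, h3, h4, e1, e2, e3, h5, h6⟩ := hFm _ hij
      simp only at h1 h2 h3 h4 e1 e2 e3 h5 h6
      rw [Finset.mem_filter]
      refine ⟨mem_sectorPairs_of_matrix hm hθ₁ hθ hρ₁ hρ₂ hαρ hc hb₃ hI hX₁ hX₂ ha₁ ha₂
        (hs₁.trans_le (mul_le_mul_of_nonneg_left hsq (sub_pos.2 hb₂).le))
        (hs₂.trans_le (mul_le_mul_of_nonneg_left hsq (sub_pos.2 hb₂).le))
        h1 h2 h3 h4 e1 e2 e3 h5 h6, ?_⟩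
      simp only [hφ, e1, e2, Nat.add_sub_cancel_left]
    have h7 : (F.card : ℝ) ≤ ((P.filter fun ij => φ ij = (D, a)).card : ℝ) := by
      exact_mod_cast Finset.card_le_card hsub
    refine le_trans ?_ h7
    refine le_trans ?_ hF
    have h8 : (m * D / θ₁ - m * D / θ₂) / (m * D) = 1 / θ₁ - 1 / θ₂ := by
      field_simp
    rw [h8, sub_mul _ (1 : ℝ), one_mul]
    -- The rounding loss of 1 is at most gcd(D, a), hence the -1 inside the common factor.
    have h9 : (1 : ℝ) ≤ Nat.gcd D a := by
      exact_mod_cast Nat.gcd_pos_of_pos_left a hD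
    linarith
  rw [Finset.mul_sum]
  refine (Finset.sum_le_sum hfib).trans ?_
  rw [← Nat.cast_sum]
  have : (P.filter fun ij => φ ij ∈ V).card = ∑ v ∈ V, (P.filter fun ij => φ ij = v).card := by
    rw [Finset.card_eq_sum_card_fiberwise (f := φ) (t := V)]
    · refine Finset.sum_congr rfl fun v hv => ?_
      congr 1
      ext ij
      simp only [Finset.mem_filter]
      constructor
      · rintro ⟨⟨h1, _⟩, h2⟩; exact ⟨h1, h2⟩
      · rintro ⟨h1, h2⟩; exact ⟨⟨h1, h2 ▸ hv⟩, h2⟩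
    · intro ij hij
      exact (Finset.mem_filter.1 hij).2
  rw [← this]
  exact_mod_cast Finset.card_filter_le _ _

theorem eventually_le_card_sectorPairs {I : Set ℝ} {k m n : ℕ}
    {θ₁ θ₂ ρ₁ ρ₂ b₁ b₂ b₃ c : ℝ} (hk : 0 < k) (hm : 0 < m) (hn : 0 < n) (hmn : Nat.Coprime m n)
    (hθ₁ : 0 < θ₁) (hθ : θ₁ < θ₂) (hθ₂ : θ₂ ≤ 1) (hρ₁ : 0 < ρ₁) (hρ : θ₂ * ρ₁ ≤ θ₁ * ρ₂)
    (hρ₂ : ρ₂ ≤ 1) (hαρ : (n / m + θ₂ / m ^ 2) * ρ₂ ≤ 1) (hc : c ≤ (n / m + θ₁ / m ^ 2) * ρ₁ ^ 2)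
    (hb₁ : 0 ≤ b₁) (hb : b₁ ≤ b₂) (hb₂ : b₂ < b₃) (hb₃ : b₃ ≤ 1) (hI : Set.Ioo b₁ b₃ ⊆ I)
    {L : ℝ} (hL : L < (1 / θ₁ - 1 / θ₂ - 1) *
      (meanWeight k * ((b₂ - b₁) * ((θ₁ * ρ₂ / m) ^ 2 - (θ₂ * ρ₁ / m) ^ 2) / 2))) :
    ∀ᶠ Q : ℕ in atTop, L * (Q : ℝ) ^ 2 ≤
      ((sectorPairs I Q k (c * (Q : ℝ) ^ 2) (n / m + θ₁ / m ^ 2)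
        (n / m + θ₂ / m ^ 2)).card : ℝ) := by
  have hm' : (0 : ℝ) < m := by exact_mod_cast hm
  have hm1 : (1 : ℝ) ≤ m := by exact_mod_cast hm
  have hθ₂' : 0 < θ₂ := hθ₁.trans hθ
  have hb32 := sub_pos.2 hb₂
  have hlim := (tendsto_sum_gcdWeight_trapezoid (X₁ := θ₂ * ρ₁ / m) (X₂ := θ₁ * ρ₂ / m)
    (b₁ := b₁) (b₂ := b₂) (by positivity) (by gcongr)
    ((div_le_one hm').2 (by nlinarith)) hb₁ hb (hb₂.le.trans hb₃) hk).const_mul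
      (1 / θ₁ - 1 / θ₂ - 1)
  have hsq : Tendsto (fun Q : ℕ => (b₃ - b₂) * (θ₂ * ρ₁ / m * (Q : ℝ)) ^ 2) atTop atTop :=
    ((tendsto_pow_atTop two_ne_zero).comp
      (tendsto_natCast_atTop_atTop.const_mul_atTop (by positivity))).const_mul_atTop hb32
  filter_upwards [hlim.eventually_const_lt hL, hsq.eventually_gt_atTop ((k : ℝ) * θ₂),
    hsq.eventually_gt_atTop ((k : ℝ) * n * m), eventually_gt_atTop 0] with Q h1 h2 h3 hQ
  have hQ' : (0 : ℝ) < Q := by exact_mod_cast hQ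
  refine le_trans ?_ (sum_gcdWeight_le_card_sectorPairs hm hn hmn hθ₁ hθ hρ₁ hρ₂ hαρ hc hb₂ hb₃
    hI hQ h2 h3)
  rw [← mul_div_assoc, lt_div_iff₀ (by positivity)] at h1
  exact h1.le

/-! ### Covering the slopes by intervals near rationals -/

/-- Dirichlet gives infinitely many such approximations, and only finitely many have denominator
below M. -/
theorem exists_rat_abs_sub_lt_of_den_ge {x : ℝ} (hx : Irrational x) (M : ℕ) :
    ∃ q : ℚ, M ≤ q.den ∧ |x - q| < 1 / (q.den : ℝ) ^ 2 := by
  by_contra! hcon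
  refine Real.infinite_rat_abs_sub_lt_one_div_den_sq_of_irrational hx ?_
  set K : ℤ := ⌈(M : ℝ) * (|x| + 1)⌉ with hK
  have hfin : (Set.Icc (-K) K ×ˢ Set.Iic M).Finite := (Set.finite_Icc _ _).prod (Set.finite_Iic _)
  refine Set.Finite.of_finite_image (f := fun q : ℚ => (q.num, q.den)) (hfin.subset ?_) ?_
  · rintro _ ⟨q, hq, rfl⟩
    have hq' : |x - q| < 1 / (q.den : ℝ) ^ 2 := hq
    have hM : q.den < M := by
      by_contra h
      exact absurd hq' (not_lt.2 (hcon q (not_lt.1 h)))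
    have hd : (1 : ℝ) ≤ q.den := by exact_mod_cast q.den_pos
    have h1 : |x - q| ≤ 1 := hq'.le.trans (by
      rw [div_le_one (by positivity)]
      exact one_le_pow₀ hd)
    have h2 : |(q : ℝ)| ≤ |x| + 1 := by
      have := abs_sub_abs_le_abs_sub (q : ℝ) x
      rw [abs_sub_comm] at this
      linarith
    have h3 : (q.num : ℝ) = q * q.den := by
      exact_mod_cast (Rat.mul_den_eq_num q).symm
    have h4 : |(q.num : ℝ)| ≤ M * (|x| + 1) := by
      rw [h3, abs_mul, mul_comm, abs_of_nonneg (a := (q.den : ℝ)) (by positivity)]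
      have : (q.den : ℝ) ≤ M := by exact_mod_cast hM.le
      gcongr
    have h5 : |q.num| ≤ K := by
      have : ((|q.num| : ℤ) : ℝ) ≤ K := by
        push_cast
        exact h4.trans (Int.le_ceil _)
      exact_mod_cast this
    exact ⟨abs_le.1 h5, hM.le⟩
  · intro q _ r _ h
    simp only [Prod.mk.injEq] at h
    exact Rat.ext h.1 h.2

/-- The interval of slopes slightly above `n / m` attached to `v = (m, n)`. -/
def slopeInterval (θ₁ θ₂ : ℝ) (v : ℕ × ℕ) : Set ℝ :=
  Set.Icc ((v.2 : ℝ) / v.1 + θ₁ / (v.1 : ℝ) ^ 2) ((v.2 : ℝ) / v.1 + θ₂ / (v.1 : ℝ) ^ 2)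

/-- Small intervals of slopes near rational numbers, disjoint from each other, exhaust any bounded
interval of positive numbers. -/
theorem exists_slopeInterval_cover {a b θ₁ θ₂ δ ε : ℝ} (ha : 0 < a) (hθ₁ : 0 < θ₁)
    (hθ : θ₁ < θ₂) (hθ₂ : θ₂ ≤ 1) (hδ : 0 < δ) (hε : 0 < ε) {f : ℝ → ℝ}
    (hf : IntegrableOn f (Set.Icc a b)) :
    ∃ u : Finset (ℕ × ℕ), (∀ v ∈ u, 0 < v.1 ∧ 0 < v.2 ∧ Nat.Coprime v.1 v.2 ∧
        slopeInterval θ₁ θ₂ v ⊆ Set.Icc a b ∧ (θ₂ - θ₁) / (v.1 : ℝ) ^ 2 ≤ δ) ∧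
      (u : Set (ℕ × ℕ)).PairwiseDisjoint (slopeInterval θ₁ θ₂) ∧
      (∫ x in Set.Icc a b, f x) - ε ≤ ∑ v ∈ u, ∫ x in slopeInterval θ₁ θ₂ v, f x := by
  have hθ₂' : 0 < θ₂ := hθ₁.trans hθ
  have hθd : 0 < θ₂ - θ₁ := sub_pos.2 hθ
  let t : Set (ℝ × (ℕ × ℕ)) := {i | 0 < i.2.1 ∧ 0 < i.2.2 ∧ Nat.Coprime i.2.1 i.2.2 ∧
    slopeInterval θ₁ θ₂ i.2 ⊆ Set.Icc a b ∧ (θ₂ - θ₁) / (i.2.1 : ℝ) ^ 2 ≤ δ ∧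
    |i.1 - (i.2.2 : ℝ) / i.2.1| < 1 / (i.2.1 : ℝ) ^ 2}
  let s : Set ℝ := {x | Irrational x ∧ x ∈ Set.Ioo a b}
  have hlt : ∀ i ∈ t, (i.2.2 : ℝ) / i.2.1 + θ₁ / (i.2.1 : ℝ) ^ 2 <
      (i.2.2 : ℝ) / i.2.1 + θ₂ / (i.2.1 : ℝ) ^ 2 := by
    intro i hi
    have : (0 : ℝ) < i.2.1 := by exact_mod_cast hi.1
    gcongr
  have hcover : ∃ u ⊆ t, u.Countable ∧ u.PairwiseDisjoint (fun i => slopeInterval θ₁ θ₂ i.2) ∧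
      volume (s \ ⋃ i ∈ u, slopeInterval θ₁ θ₂ i.2) = 0 := by
    -- The covering sets need not contain x: it is enough that they fill a fixed proportion of balls
    -- about x. The ball of radius 2/m² contains the slope interval, and tripling it gives measure
    -- 12/m², whence the constant.
    refine Vitali.exists_disjoint_covering_ae volume s t
      (12 / (θ₂ - θ₁)).toNNReal (fun i => 2 / (i.2.1 : ℝ) ^ 2) (fun i => i.1)
      (fun i => slopeInterval θ₁ θ₂ i.2) ?_ ?_ ?_ ?_ ?_
    · rintro ⟨x, m, n⟩ ⟨hm, _, _, _, _, hx⟩ y ⟨hy1, hy2⟩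
      simp only at hm hx hy1 hy2
      have hm' : (0 : ℝ) < m := by exact_mod_cast hm
      rw [Metric.mem_closedBall, Real.dist_eq]
      rw [abs_lt] at hx
      have h1 : θ₂ / (m : ℝ) ^ 2 ≤ 1 / (m : ℝ) ^ 2 := by gcongr
      have h2 : 0 < θ₁ / (m : ℝ) ^ 2 := by positivity
      have h3 : 2 / (m : ℝ) ^ 2 = 1 / (m : ℝ) ^ 2 + 1 / (m : ℝ) ^ 2 := by ring
      simp only [h3]
      rw [abs_le]
      constructor <;> linarith [hx.1, hx.2]
    · rintro ⟨x, m, n⟩ ⟨hm, _⟩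
      simp only at hm
      have hm' : (0 : ℝ) < m := by exact_mod_cast hm
      rw [slopeInterval, Real.volume_closedBall, Real.volume_Icc]
      change _ ≤ ENNReal.ofReal (12 / (θ₂ - θ₁)) * _
      rw [← ENNReal.ofReal_mul (by positivity)]
      refine ENNReal.ofReal_le_ofReal (le_of_eq ?_)
      simp only
      field_simp
      ring
    · intro i hi
      rw [slopeInterval, interior_Icc, Set.nonempty_Ioo]
      exact hlt i hi
    · intro i _
      exact isClosed_Icc
    · rintro x ⟨hxi, hx1, hx2⟩ ε' hε'
      have hsq : Tendsto (fun m : ℕ => 2 / (m : ℝ) ^ 2) atTop (𝓝 0) :=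
        tendsto_const_nhds.div_atTop
          ((tendsto_pow_atTop two_ne_zero).comp tendsto_natCast_atTop_atTop)
      obtain ⟨M, hM⟩ := eventually_atTop.1 ((((hsq.eventually_lt_const hε').and
        (hsq.eventually_lt_const hδ)).and (hsq.eventually_lt_const (sub_pos.2 hx1))).and
        (hsq.eventually_lt_const (sub_pos.2 hx2)))
      obtain ⟨q, hqM, hq⟩ := exists_rat_abs_sub_lt_of_den_ge hxi M
      obtain ⟨⟨⟨h1, h2⟩, h3⟩, h4⟩ := hM q.den hqM
      have hm' : (0 : ℝ) < q.den := by exact_mod_cast q.den_pos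
      have h0 : 0 < 1 / (q.den : ℝ) ^ 2 := by positivity
      have h12 : 2 / (q.den : ℝ) ^ 2 = 1 / (q.den : ℝ) ^ 2 + 1 / (q.den : ℝ) ^ 2 := by ring
      have hqa := abs_lt.1 hq
      have hqpos : 0 < q := by
        have : (0 : ℝ) < q := by linarith [hqa.2]
        exact_mod_cast this
      have hnum : 0 < q.num := Rat.num_pos.2 hqpos
      obtain ⟨n, hn⟩ := Int.eq_ofNat_of_zero_le hnum.le
      have hqn : (q : ℝ) = (n : ℝ) / q.den := by
        conv_lhs => rw [← Rat.num_div_den q]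
        rw [hn]
        push_cast
        rfl
      have hnpos : 0 < n := by omega
      have hcop : Nat.Coprime q.den n := by
        have := q.reduced
        rw [hn] at this
        exact this.symm
      have g1 : θ₂ / (q.den : ℝ) ^ 2 ≤ 1 / (q.den : ℝ) ^ 2 := by gcongr
      have g2 : 0 < θ₁ / (q.den : ℝ) ^ 2 := by positivity
      rw [hqn] at hq hqa
      refine ⟨(x, (q.den, n)), ⟨q.den_pos, hnpos, hcop, ?_, ?_, hq⟩, h1.le, rfl⟩
      · rintro y ⟨hy1, hy2⟩
        simp only at hy1 hy2
        constructor <;> linarith [hqa.1, hqa.2]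
      · simp only
        rw [sub_div]
        linarith
  obtain ⟨u, hut, hucount, hudisj, hunull⟩ := hcover
  -- Two centres with the same (m, n) would carry the same nonempty interval, against disjointness.
  have hinj : Set.InjOn Prod.snd u := by
    intro i hi j hj hij
    by_contra hne
    refine Set.not_disjoint_iff.2 ?_ (hudisj hi hj hne)
    refine ⟨_, Set.left_mem_Icc.2 (hlt i (hut hi)).le, ?_⟩
    rw [hij]
    exact Set.left_mem_Icc.2 (hlt j (hut hj)).le
  have : Countable u := hucount.to_subtype
  have hsub : (⋃ i : u, slopeInterval θ₁ θ₂ i.1.2) ⊆ Set.Icc a b :=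
    Set.iUnion_subset fun i => (hut i.2).2.2.2.1
  have hsum : HasSum (fun i : u => ∫ x in slopeInterval θ₁ θ₂ i.1.2, f x)
      (∫ x in ⋃ i : u, slopeInterval θ₁ θ₂ i.1.2, f x) := by
    refine hasSum_integral_iUnion (fun i => measurableSet_Icc) ?_ (hf.mono_set hsub)
    intro i j hij
    exact hudisj i.2 j.2 (fun h => hij (Subtype.ext h))
  have hae : (⋃ i : u, slopeInterval θ₁ θ₂ i.1.2 : Set ℝ) =ᵐ[volume] Set.Icc a b := by
    refine (LE.le.eventuallyLE hsub).antisymm ?_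
    rw [ae_le_set]
    have h1 : Set.Icc a b \ ⋃ i : u, slopeInterval θ₁ θ₂ i.1.2 ⊆
        (s \ ⋃ i ∈ u, slopeInterval θ₁ θ₂ i.2) ∪ (Set.range ((↑) : ℚ → ℝ) ∪ {a, b}) := by
      rintro x ⟨⟨hx1, hx2⟩, hx3⟩
      by_cases hx : x ∈ Set.range ((↑) : ℚ → ℝ) ∪ {a, b}
      · exact Or.inr hx
      left
      rw [Set.mem_union, not_or] at hx
      simp only [Set.mem_insert_iff, Set.mem_singleton_iff, not_or] at hx
      refine ⟨⟨hx.1, lt_of_le_of_ne hx1 (Ne.symm hx.2.1), lt_of_le_of_ne hx2 hx.2.2⟩, ?_⟩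
      rwa [Set.biUnion_eq_iUnion]
    refine measure_mono_null h1 (measure_union_null hunull ?_)
    exact ((Set.countable_range _).union (Set.toFinite {a, b}).countable).measure_zero _
  rw [setIntegral_congr_set hae] at hsum
  obtain ⟨w, hw⟩ := (hsum.eventually_const_lt (sub_lt_self _ hε)).exists
  refine ⟨w.image fun i => i.1.2, ?_, ?_, ?_⟩
  · intro v hv
    obtain ⟨i, _, rfl⟩ := Finset.mem_image.1 hv
    obtain ⟨h1, h2, h3, h4, h5, _⟩ := hut i.2
    exact ⟨h1, h2, h3, h4, h5⟩
  · intro v hv v' hv' hne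
    obtain ⟨i, _, rfl⟩ := Finset.mem_image.1 hv
    obtain ⟨j, _, rfl⟩ := Finset.mem_image.1 hv'
    exact hudisj i.2 j.2 (fun h => hne (by rw [h]))
  · rw [Finset.sum_image]
    · exact hw.le
    · intro i _ j _ hij
      exact Subtype.ext (hinj i.2 j.2 hij)

/-! ### Summing the sectors: the lower bound for a given determinant -/

/-- The density of the slope `y / x` on the region `x y ≥ c` of the unit square. -/
def slopeDensity (c x : ℝ) : ℝ := ((min 1 x⁻¹) ^ 2 - c / x) / 2

theorem continuousOn_slopeDensity {c : ℝ} {s : Set ℝ} (hs : ∀ x ∈ s, 0 < x) :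
    ContinuousOn (slopeDensity c) s := by
  have hinv : ContinuousOn (fun x : ℝ => x⁻¹) s := continuousOn_inv₀.mono fun x hx => (hs x hx).ne'
  have hmin : ContinuousOn (fun x : ℝ => min 1 x⁻¹) s :=
    fun x hx => Tendsto.min tendsto_const_nhds (hinv x hx)
  exact ((hmin.pow 2).sub (continuousOn_const.div continuousOn_id
    fun x hx => (hs x hx).ne')).div_const 2

/-- Area in the coordinates (x, s) with y = sx: the element is x dx ds, and x runs from √(c/s) to
min(1, 1/s). -/
theorem integral_slopeDensity {c : ℝ} (hc : 0 < c) (hc1 : c < 1) :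
    ∫ x in Set.Icc c c⁻¹, slopeDensity c x = hyperbolaArea c := by
  have h1c : 1 ≤ c⁻¹ := (one_le_inv₀ hc).2 hc1.le
  rw [integral_Icc_eq_integral_Ioc, ← intervalIntegral.integral_of_le (hc1.le.trans h1c),
    ← intervalIntegral.integral_add_adjacent_intervals (b := 1)]
  rotate_left
  · exact ContinuousOn.intervalIntegrable_of_Icc hc1.le
      (continuousOn_slopeDensity fun x hx => hc.trans_le hx.1)
  · exact ContinuousOn.intervalIntegrable_of_Icc h1c
      (continuousOn_slopeDensity fun x hx => zero_lt_one.trans_le hx.1)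
  have e1 : ∫ x in c..1, slopeDensity c x = (1 - c + c * Real.log c) / 2 := by
    have hd : ∀ x ∈ Set.uIcc c 1, HasDerivAt (fun x => (x - c * Real.log x) / 2)
        (slopeDensity c x) x := by
      intro x hx
      rw [Set.uIcc_of_le hc1.le] at hx
      have hx0 : 0 < x := hc.trans_le hx.1
      refine HasDerivAt.congr_deriv (((hasDerivAt_id' x).fun_sub
        ((Real.hasDerivAt_log hx0.ne').const_mul c)).div_const 2) ?_
      rw [slopeDensity, min_eq_left ((one_le_inv₀ hx0).2 hx.2)]
      ring
    rw [intervalIntegral.integral_eq_sub_of_hasDerivAt hd]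
    · simp; ring
    · exact ContinuousOn.intervalIntegrable_of_Icc hc1.le
        (continuousOn_slopeDensity fun x hx => hc.trans_le hx.1)
  have e2 : ∫ x in (1 : ℝ)..c⁻¹, slopeDensity c x = (1 - c + c * Real.log c) / 2 := by
    have hd : ∀ x ∈ Set.uIcc 1 c⁻¹, HasDerivAt (fun x => (-x⁻¹ - c * Real.log x) / 2)
        (slopeDensity c x) x := by
      intro x hx
      rw [Set.uIcc_of_le h1c] at hx
      have hx0 : 0 < x := zero_lt_one.trans_le hx.1
      refine HasDerivAt.congr_deriv (((hasDerivAt_inv hx0.ne').fun_neg.fun_sub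
        ((Real.hasDerivAt_log hx0.ne').const_mul c)).div_const 2) ?_
      rw [slopeDensity, min_eq_right (inv_le_one_of_one_le₀ hx.1)]
      field_simp
    rw [intervalIntegral.integral_eq_sub_of_hasDerivAt hd]
    · simp; ring
    · exact ContinuousOn.intervalIntegrable_of_Icc h1c
        (continuousOn_slopeDensity fun x hx => zero_lt_one.trans_le hx.1)
  rw [e1, e2, hyperbolaArea]
  ring

/-- Before halving, the squared minimum loses at most 4η, because (1 - η)⁴ ≥ 1 - 4η, and c/x changes
by at most η; half of 5η is below 3η. -/
theorem slopeDensity_sub_le {c η x x₁ x₂ : ℝ} (hc : 0 < c) (hη : 0 < η) (hη1 : η < 1)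
    (h1 : c ≤ x₁) (hx₁ : x₁ ≤ x) (hx₂ : x ≤ x₂) (h12 : x₂ - x₁ ≤ η * c) :
    slopeDensity c x - 3 * η ≤ ((1 - η) ^ 2 * (min 1 x₂⁻¹) ^ 2 - c / x₁) / 2 := by
  have hx₁0 : 0 < x₁ := hc.trans_le h1
  have hx0 : 0 < x := hx₁0.trans_le hx₁
  have hx₂0 : 0 < x₂ := hx0.trans_le hx₂
  have e1 : c / x₁ - c / x ≤ η := by
    rw [div_sub_div _ _ hx₁0.ne' hx0.ne', div_le_iff₀ (by positivity)]
    have h3 : x - x₁ ≤ η * c := by linarith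
    calc c * x - x₁ * c = c * (x - x₁) := by ring
      _ ≤ c * (η * c) := by gcongr
      _ = η * (c * c) := by ring
      _ ≤ η * (x₁ * x) := by gcongr; exact h1.trans hx₁
  have hη' : 0 < 1 - η := by linarith
  have e2 : (1 - η) * min 1 x⁻¹ ≤ min 1 x₂⁻¹ := by
    refine le_min ?_ ?_
    · calc (1 - η) * min 1 x⁻¹ ≤ (1 - η) * 1 := by gcongr; exact min_le_left _ _
        _ ≤ 1 := by linarith
    · have h4 : x₂ * (1 - η) ≤ x := by nlinarith
      calc (1 - η) * min 1 x⁻¹ ≤ (1 - η) * x⁻¹ := by gcongr; exact min_le_right _ _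
        _ ≤ x₂⁻¹ := by
          rw [← div_eq_mul_inv, div_le_iff₀ hx0, inv_mul_eq_div, le_div_iff₀ hx₂0]
          linarith
  set μ := min 1 x⁻¹
  have hμ0 : 0 ≤ μ := le_min zero_le_one (by positivity)
  have hμ1 : μ ≤ 1 := min_le_left _ _
  have e3 : ((1 - η) * μ) ^ 2 ≤ (min 1 x₂⁻¹) ^ 2 := by gcongr
  have e4 : (1 - η) ^ 2 * ((1 - η) * μ) ^ 2 ≤ (1 - η) ^ 2 * (min 1 x₂⁻¹) ^ 2 := by gcongr
  have e5 : 1 - 4 * η ≤ (1 - η) ^ 4 := by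
    have := one_add_mul_le_pow (a := -η) (by linarith) 4
    norm_num at this
    rw [← sub_eq_add_neg] at this
    linarith
  have e6 : μ ^ 2 - 4 * η ≤ (1 - η) ^ 2 * ((1 - η) * μ) ^ 2 := by
    have h5 : (1 - η) ^ 2 * ((1 - η) * μ) ^ 2 = (1 - η) ^ 4 * μ ^ 2 := by ring
    have h6 : μ ^ 2 ≤ 1 := by nlinarith
    have h7 : (1 - 4 * η) * μ ^ 2 ≤ (1 - η) ^ 4 * μ ^ 2 := by gcongr
    rw [h5]
    nlinarith
  rw [slopeDensity]
  linarith

/-- The choice θ₂ = η², θ₁ = (1 - η)η² meets two demands. The ratio θ₁/θ₂ is near 1, so little is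
lost in the range of D, yet 1/θ₁ - 1/θ₂ = 1/(η(1 - η)) is large, so the rounding loss of 1 is
negligible. -/
theorem eventually_le_card_slope {I : Set ℝ} {k m n : ℕ} {η b₁ b₂ b₃ c : ℝ} (hk : 0 < k)
    (hm : 0 < m) (hn : 0 < n) (hmn : Nat.Coprime m n) (hη : 0 < η) (hη1 : η < 1) (hc : 0 < c)
    (hsub : slopeInterval ((1 - η) * η ^ 2) (η ^ 2) (m, n) ⊆ Set.Icc c c⁻¹)
    (hδ : (η ^ 2 - (1 - η) * η ^ 2) / (m : ℝ) ^ 2 ≤ η * c)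
    (hb₁ : 0 ≤ b₁) (hb : b₁ ≤ b₂) (hb₂ : b₂ < b₃) (hb₃ : b₃ ≤ 1) (hI : Set.Ioo b₁ b₃ ⊆ I)
    {ε : ℝ} (hε : 0 < ε) :
    ∀ᶠ Q : ℕ in atTop, (meanWeight k * (b₂ - b₁) *
        (∫ x in slopeInterval ((1 - η) * η ^ 2) (η ^ 2) (m, n), (slopeDensity c x - 3 * η)) - ε) *
        (Q : ℝ) ^ 2 ≤
      ((sectorPairs I Q k (c * (Q : ℝ) ^ 2) (n / m + (1 - η) * η ^ 2 / m ^ 2)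
        (n / m + η ^ 2 / m ^ 2)).card : ℝ) := by
  have hm' : (0 : ℝ) < m := by exact_mod_cast hm
  have hη' : 0 < 1 - η := by linarith
  set x₁ : ℝ := n / m + (1 - η) * η ^ 2 / m ^ 2 with hx₁
  set x₂ : ℝ := n / m + η ^ 2 / m ^ 2 with hx₂
  have h12 : x₂ - x₁ = η ^ 3 / m ^ 2 := by rw [hx₁, hx₂]; ring
  have hle : x₁ ≤ x₂ := by
    have : 0 < η ^ 3 / (m : ℝ) ^ 2 := by positivity
    linarith
  have hJ : slopeInterval ((1 - η) * η ^ 2) (η ^ 2) (m, n) = Set.Icc x₁ x₂ := rfl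
  rw [hJ] at hsub ⊢
  have hcx : c ≤ x₁ := (hsub (Set.left_mem_Icc.2 hle)).1
  have hx₁0 : 0 < x₁ := hc.trans_le hcx
  have hx₂0 : 0 < x₂ := hx₁0.trans_le hle
  have hδ' : x₂ - x₁ ≤ η * c := by
    rw [h12]
    refine le_trans (le_of_eq ?_) hδ
    ring
  set ρ₂ := min 1 x₂⁻¹ with hρ₂
  set ρ₁ := Real.sqrt (c / x₁) with hρ₁
  set h := ((1 - η) ^ 2 * ρ₂ ^ 2 - c / x₁) / 2 with hh
  have hκ : 0 ≤ meanWeight k * (b₂ - b₁) := mul_nonneg (meanWeight_nonneg k) (sub_nonneg.2 hb)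
  have hint : ∫ x in Set.Icc x₁ x₂, (slopeDensity c x - 3 * η) ≤ (x₂ - x₁) * h := by
    have h1 : ∫ x in Set.Icc x₁ x₂, (slopeDensity c x - 3 * η) ≤ ∫ _ in Set.Icc x₁ x₂, h := by
      refine setIntegral_mono_on ?_ ?_ measurableSet_Icc ?_
      · exact (((continuousOn_slopeDensity fun x hx => hx₁0.trans_le hx.1).sub
          continuousOn_const).integrableOn_compact isCompact_Icc)
      · exact (continuousOn_const.integrableOn_compact isCompact_Icc)
      · intro x hx
        exact slopeDensity_sub_le hc hη hη1 hcx hx.1 hx.2 hδ'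
    refine h1.trans (le_of_eq ?_)
    rw [setIntegral_const, Real.volume_real_Icc_of_le hle, smul_eq_mul]
  have hρ₁sq : ρ₁ ^ 2 = c / x₁ := Real.sq_sqrt (by positivity)
  have hρ₁0 : 0 < ρ₁ := Real.sqrt_pos.2 (by positivity)
  have hρ₂0 : 0 < ρ₂ := lt_min zero_lt_one (by positivity)
  -- Otherwise the trapezoid degenerates; but then h ≤ 0 and the claimed bound is nonpositive.
  rcases le_or_gt ρ₁ ((1 - η) * ρ₂) with hcase | hcase
  · have hh0 : 0 ≤ h := by
      rw [hh, ← hρ₁sq]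
      have : ρ₁ ^ 2 ≤ ((1 - η) * ρ₂) ^ 2 := by gcongr
      have : ((1 - η) * ρ₂) ^ 2 = (1 - η) ^ 2 * ρ₂ ^ 2 := by ring
      linarith
    refine eventually_le_card_sectorPairs (ρ₁ := ρ₁) (ρ₂ := ρ₂) (b₂ := b₂) hk hm hn hmn
      (by positivity) (by
        have := mul_pos hη (pow_pos hη 2)
        linarith) (pow_le_one₀ hη.le hη1.le) hρ₁0 ?_ (min_le_left _ _) ?_ ?_
      hb₁ hb hb₂ hb₃ hI ?_
    · calc η ^ 2 * ρ₁ ≤ η ^ 2 * ((1 - η) * ρ₂) := by gcongr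
        _ = _ := by ring
    · calc x₂ * ρ₂ ≤ x₂ * x₂⁻¹ := by gcongr; exact min_le_right _ _
        _ = 1 := mul_inv_cancel₀ hx₂0.ne'
    · rw [hρ₁sq]
      exact (mul_div_cancel₀ c hx₁0.ne').ge
    · have e1 : (1 / ((1 - η) * η ^ 2) - 1 / η ^ 2 - 1) *
          (meanWeight k * ((b₂ - b₁) * (((1 - η) * η ^ 2 * ρ₂ / m) ^ 2 -
            (η ^ 2 * ρ₁ / m) ^ 2) / 2)) =
          meanWeight k * (b₂ - b₁) * ((1 / (1 - η) - η) * ((x₂ - x₁) * h)) := by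
        rw [h12, hh, ← hρ₁sq]
        field_simp
        ring
      rw [e1]
      -- The gain in 1/(1 - η) ≥ 1 + η pays for the rounding loss, which is η after normalisation.
      have e2 : (1 : ℝ) ≤ 1 / (1 - η) - η := by
        rw [le_sub_iff_add_le, le_div_iff₀ hη']
        nlinarith
      have e3 : (x₂ - x₁) * h ≤ (1 / (1 - η) - η) * ((x₂ - x₁) * h) :=
        le_mul_of_one_le_left (mul_nonneg (sub_nonneg.2 hle) hh0) e2
      have e4 := mul_le_mul_of_nonneg_left (hint.trans e3) hκ
      linarith
  · refine Eventually.of_forall fun Q => ?_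
    have hh0 : h ≤ 0 := by
      rw [hh, ← hρ₁sq]
      have : ((1 - η) * ρ₂) ^ 2 ≤ ρ₁ ^ 2 := by gcongr
      have : ((1 - η) * ρ₂) ^ 2 = (1 - η) ^ 2 * ρ₂ ^ 2 := by ring
      linarith
    have e1 : ∫ x in Set.Icc x₁ x₂, (slopeDensity c x - 3 * η) ≤ 0 :=
      hint.trans (mul_nonpos_of_nonneg_of_nonpos (sub_nonneg.2 hle) hh0)
    have e2 := mul_nonpos_of_nonneg_of_nonpos hκ e1
    refine le_trans (mul_nonpos_of_nonpos_of_nonneg (by linarith) (by positivity)) ?_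
    positivity

theorem sum_card_sectorPairs_le (I : Set ℝ) (Q k : ℕ) (B θ₁ θ₂ : ℝ) (u : Finset (ℕ × ℕ))
    (hu : (u : Set (ℕ × ℕ)).PairwiseDisjoint (slopeInterval θ₁ θ₂)) :
    ∑ v ∈ u, (sectorPairs I Q k B ((v.2 : ℝ) / v.1 + θ₁ / (v.1 : ℝ) ^ 2)
      ((v.2 : ℝ) / v.1 + θ₂ / (v.1 : ℝ) ^ 2)).card ≤ (detPairs I Q k B).card := by
  rw [← Finset.card_biUnion]
  · exact Finset.card_le_card (Finset.biUnion_subset.2 fun v _ => Finset.filter_subset _ _)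
  · intro v hv w hw hne
    refine Finset.disjoint_left.2 fun ij h1 h2 => ?_
    obtain ⟨h0, h1⟩ := Finset.mem_filter.1 h1
    obtain ⟨_, h2⟩ := Finset.mem_filter.1 h2
    have hi := mem_indices.1 (mem_detPairs.1 h0).1.1
    have hq : (0 : ℝ) < ij.1.2 := by
      have : 0 < ij.1.2 := by omega
      exact_mod_cast this
    exact Set.disjoint_left.1 (hu hv hw hne)
      (show (ij.2.2 : ℝ) / ij.1.2 ∈ slopeInterval θ₁ θ₂ v from
        ⟨(le_div_iff₀ hq).2 h1.1, (div_le_iff₀ hq).2 h1.2⟩)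
      ⟨(le_div_iff₀ hq).2 h2.1, (div_le_iff₀ hq).2 h2.2⟩

/-- Lower bound for the number of pairs of fractions in an interval with given determinant. -/
theorem eventually_le_card_detPairs {I : Set ℝ} {k : ℕ} {b₁ b₃ c : ℝ} (hk : 0 < k) (hc : 0 < c)
    (hc1 : c < 1) (hb₁ : 0 ≤ b₁) (hb : b₁ ≤ b₃) (hb₃ : b₃ ≤ 1) (hI : Set.Ioo b₁ b₃ ⊆ I) {L : ℝ}
    (hL : L < meanWeight k * hyperbolaArea c * (b₃ - b₁)) :
    ∀ᶠ Q : ℕ in atTop, L * (Q : ℝ) ^ 2 ≤ ((detPairs I Q k (c * (Q : ℝ) ^ 2)).card : ℝ) := by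
  rcases hb.eq_or_lt with rfl | hlt
  · refine Eventually.of_forall fun Q => ?_
    rw [sub_self, mul_zero] at hL
    exact (mul_nonpos_of_nonpos_of_nonneg hL.le (by positivity)).trans (by positivity)
  -- A single η controls every loss: the margin b₃ - b₂, the slope density, the covering error, and
  -- the total counting error over the sectors.
  have hcont : Tendsto (fun η : ℝ => meanWeight k * (b₃ - η - b₁) *
      (hyperbolaArea c - 3 * η * (c⁻¹ - c) - η) - η) (𝓝[>] 0)
      (𝓝 (meanWeight k * hyperbolaArea c * (b₃ - b₁))) := by
    have : Continuous (fun η : ℝ => meanWeight k * (b₃ - η - b₁) *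
      (hyperbolaArea c - 3 * η * (c⁻¹ - c) - η) - η) := by fun_prop
    have h := (this.tendsto 0).mono_left (nhdsWithin_le_nhds (s := Set.Ioi 0))
    convert h using 2
    ring
  obtain ⟨η, ⟨⟨hη, hη1⟩, hηb⟩, hη0⟩ := (((hcont.eventually_const_lt hL).and
    (eventually_nhdsWithin_of_eventually_nhds (eventually_lt_nhds zero_lt_one))).and
    (eventually_nhdsWithin_of_eventually_nhds (eventually_lt_nhds (sub_pos.2 hlt)))).and
    (eventually_mem_nhdsWithin (a := (0 : ℝ)) (s := Set.Ioi 0)) |>.exists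
  have hη0 : 0 < η := hη0
  have hcc : c ≤ c⁻¹ := hc1.le.trans ((one_le_inv₀ hc).2 hc1.le)
  have hintf : IntegrableOn (slopeDensity c) (Set.Icc c c⁻¹) :=
    (continuousOn_slopeDensity fun x hx => hc.trans_le hx.1).integrableOn_compact isCompact_Icc
  have hintc : IntegrableOn (fun _ : ℝ => 3 * η) (Set.Icc c c⁻¹) :=
    continuousOn_const.integrableOn_compact isCompact_Icc
  obtain ⟨u, hu, hdisj, hsum⟩ := exists_slopeInterval_cover (θ₁ := (1 - η) * η ^ 2) (θ₂ := η ^ 2)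
    (δ := η * c) (ε := η) hc (mul_pos (by linarith) (by positivity))
    (by
      have := mul_pos hη0 (pow_pos hη0 2)
      linarith) (pow_le_one₀ hη0.le hη1.le) (by positivity) hη0 (hintf.sub hintc)
  have htot : ∫ x in Set.Icc c c⁻¹, (slopeDensity c - fun _ : ℝ => 3 * η) x =
      hyperbolaArea c - 3 * η * (c⁻¹ - c) := by
    simp only [Pi.sub_apply]
    rw [integral_sub hintf hintc, integral_slopeDensity hc hc1, setIntegral_const,
      Real.volume_real_Icc_of_le hcc, smul_eq_mul]
    ring
  rw [htot] at hsum
  have hε : 0 < η / (u.card + 1) := by positivity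
  have hall := (Finset.eventually_all u).2 fun v hv =>
    eventually_le_card_slope (I := I) (b₁ := b₁) (b₂ := b₃ - η) (b₃ := b₃) hk (hu v hv).1
      (hu v hv).2.1 (hu v hv).2.2.1 hη0 hη1 hc (hu v hv).2.2.2.1 (hu v hv).2.2.2.2 hb₁
      (by linarith) (by linarith) hb₃ hI hε
  filter_upwards [hall] with Q hQ
  have h1 := Finset.sum_le_sum hQ
  have h2 : (∑ v ∈ u, ((sectorPairs I Q k (c * (Q : ℝ) ^ 2)
      ((v.2 : ℝ) / v.1 + (1 - η) * η ^ 2 / (v.1 : ℝ) ^ 2)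
      ((v.2 : ℝ) / v.1 + η ^ 2 / (v.1 : ℝ) ^ 2)).card : ℝ)) ≤
      ((detPairs I Q k (c * (Q : ℝ) ^ 2)).card : ℝ) := by
    rw [← Nat.cast_sum]
    exact Nat.cast_le.2 (sum_card_sectorPairs_le I Q k (c * (Q : ℝ) ^ 2) _ _ u hdisj)
  refine le_trans ?_ (h1.trans h2)
  rw [← Finset.sum_mul]
  gcongr
  rw [Finset.sum_sub_distrib, ← Finset.mul_sum, Finset.sum_const, nsmul_eq_mul]
  have hκ : 0 ≤ meanWeight k * (b₃ - η - b₁) :=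
    mul_nonneg (meanWeight_nonneg k) (by linarith)
  have h3 := mul_le_mul_of_nonneg_left hsum hκ
  have h4 : (u.card : ℝ) * (η / (u.card + 1)) ≤ η := by
    rw [← mul_div_assoc, div_le_iff₀ (by positivity)]
    linarith
  simp only [Pi.sub_apply] at h3
  linarith

/-! ### The integral of the density -/

theorem hyperbolaArea_one : hyperbolaArea 1 = 0 := by simp [hyperbolaArea]

theorem hasDerivAt_hyperbolaArea {c : ℝ} (hc : 0 < c) :
    HasDerivAt hyperbolaArea (Real.log c) c := by
  refine HasDerivAt.congr_deriv (((hasDerivAt_const c (1 : ℝ)).fun_sub (hasDerivAt_id' c)).fun_add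
    ((hasDerivAt_id' c).fun_mul (Real.hasDerivAt_log hc.ne'))) ?_
  field_simp
  ring

/-- Half the integral of `density` over `[0, lam]`. -/
def halfIntegral (lam : ℝ) : ℝ :=
  ∑ k ∈ Finset.Icc 1 ⌊2 * lam⌋₊, meanWeight k * hyperbolaArea (k / (2 * lam))

/-- The contribution of `k` to `density`. -/
def densityTerm (k : ℕ) (x : ℝ) : ℝ :=
  6 / (Real.pi ^ 2 * x ^ 2) * ((ArithmeticFunction.sigma 1 k : ℝ) * max 0 (Real.log (2 * x / k)))

/-- Truncating the logarithm at 0 makes the range of k independent of x, so sum and integral can be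
exchanged. -/
theorem density_eq_sum {lam x : ℝ} (hx : 0 < x) (hxl : x ≤ lam) :
    density x = ∑ k ∈ Finset.Icc 1 ⌊2 * lam⌋₊, densityTerm k x := by
  simp only [density, densityTerm]
  rw [← Finset.mul_sum]
  congr 1
  have hsub : Finset.Icc 1 ⌊2 * x⌋₊ ⊆ Finset.Icc 1 ⌊2 * lam⌋₊ :=
    Finset.Icc_subset_Icc_right (Nat.floor_mono (by linarith))
  rw [← Finset.sum_subset hsub]
  · refine Finset.sum_congr rfl fun k hk => ?_
    rw [Finset.mem_Icc, Nat.le_floor_iff (by positivity)] at hk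
    have hk0 : (0 : ℝ) < k := by exact_mod_cast hk.1
    rw [max_eq_right (Real.log_nonneg ((one_le_div hk0).2 hk.2))]
  · intro k hk hk'
    rw [Finset.mem_Icc] at hk
    have hk0 : (0 : ℝ) < k := by exact_mod_cast hk.1
    have h1 : 2 * x < k := by
      by_contra h
      exact hk' (Finset.mem_Icc.2 ⟨hk.1, (Nat.le_floor_iff (by positivity)).2 (not_lt.1 h)⟩)
    rw [max_eq_left (Real.log_nonpos (by positivity) ((div_le_one hk0).2 h1.le)), mul_zero]

theorem integral_densityTerm {lam : ℝ} {k : ℕ} (hk : 0 < k) (hkl : (k : ℝ) ≤ 2 * lam) :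
    IntervalIntegrable (densityTerm k) volume 0 lam ∧
      ∫ x in (0 : ℝ)..lam, densityTerm k x =
        2 * (meanWeight k * hyperbolaArea (k / (2 * lam))) := by
  have hk0 : (0 : ℝ) < k := by exact_mod_cast hk
  have hk2 : (0 : ℝ) < k / 2 := by positivity
  have hkl2 : (k : ℝ) / 2 ≤ lam := by linarith
  have hzero : ∀ x ∈ Set.uIcc (0 : ℝ) (k / 2), densityTerm k x = 0 := by
    intro x hx
    rw [Set.uIcc_of_le hk2.le] at hx
    have h1 : 2 * x / k ≤ 1 := (div_le_one hk0).2 (by linarith [hx.2])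
    rw [densityTerm, max_eq_left (Real.log_nonpos (div_nonneg (by linarith [hx.1]) hk0.le) h1)]
    simp
  have hval : ∀ x ∈ Set.uIcc ((k : ℝ) / 2) lam, densityTerm k x =
      6 / (Real.pi ^ 2 * x ^ 2) * ((ArithmeticFunction.sigma 1 k : ℝ) * Real.log (2 * x / k)) := by
    intro x hx
    rw [Set.uIcc_of_le hkl2] at hx
    rw [densityTerm, max_eq_right (Real.log_nonneg ((one_le_div hk0).2 (by linarith [hx.1])))]
  have hI1 : IntervalIntegrable (densityTerm k) volume 0 (k / 2) :=
    (intervalIntegrable_const (c := (0 : ℝ))).congr fun x hx =>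
      (hzero x (Set.uIoc_subset_uIcc hx)).symm
  have hI2 : IntervalIntegrable (densityTerm k) volume (k / 2) lam := by
    refine ContinuousOn.intervalIntegrable (ContinuousOn.congr ?_ hval)
    rw [Set.uIcc_of_le hkl2]
    have hne : ∀ x ∈ Set.Icc ((k : ℝ) / 2) lam, x ≠ 0 := fun x hx => (hk2.trans_le hx.1).ne'
    refine ContinuousOn.mul (continuousOn_const.div (by fun_prop) fun x hx => ?_)
      (continuousOn_const.mul (ContinuousOn.log (by fun_prop) fun x hx => ?_))
    · have := hne x hx
      have := Real.pi_ne_zero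
      positivity
    · have := hne x hx
      positivity
  refine ⟨hI1.trans hI2, ?_⟩
  have e1 : ∫ x in (0 : ℝ)..(k / 2), densityTerm k x = 0 := by
    rw [intervalIntegral.integral_congr hzero]
    simp
  -- `hyperbolaArea` has derivative log, so the chain rule with c = k/(2x) gives exactly this
  -- primitive, vanishing at x = k/2.
  have hd : ∀ x ∈ Set.uIcc ((k : ℝ) / 2) lam,
      HasDerivAt (fun x : ℝ => 2 * (meanWeight k * hyperbolaArea (k / (2 * x))))
        (densityTerm k x) x := by
    intro x hx
    rw [hval x hx]
    rw [Set.uIcc_of_le hkl2] at hx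
    have hx0 : 0 < x := hk2.trans_le hx.1
    have h1 : HasDerivAt (fun x : ℝ => (k : ℝ) / (2 * x)) (-(k / (2 * x ^ 2))) x := by
      refine HasDerivAt.congr_deriv ((hasDerivAt_const x (k : ℝ)).fun_div
        ((hasDerivAt_id' x).const_mul 2) (by positivity)) ?_
      field_simp
      ring
    have h2 := (hasDerivAt_hyperbolaArea (c := k / (2 * x)) (by positivity)).comp x h1
    refine HasDerivAt.congr_deriv ((h2.const_mul (meanWeight k)).const_mul 2) ?_
    have h3 : Real.log (k / (2 * x)) = - Real.log (2 * x / k) := by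
      rw [← Real.log_inv, inv_div]
    rw [h3, meanWeight]
    have := Real.pi_pos
    field_simp
  rw [← intervalIntegral.integral_add_adjacent_intervals hI1 hI2, e1,
    intervalIntegral.integral_eq_sub_of_hasDerivAt hd hI2]
  have h4 : (k : ℝ) / (2 * (k / 2)) = 1 := by field_simp
  rw [h4, hyperbolaArea_one]
  ring

theorem integral_density {lam : ℝ} (hl : 0 < lam) :
    IntervalIntegrable density volume 0 lam ∧
      ∫ x in (0 : ℝ)..lam, density x = 2 * halfIntegral lam := by
  have hterm : ∀ k ∈ Finset.Icc 1 ⌊2 * lam⌋₊, IntervalIntegrable (densityTerm k) volume 0 lam ∧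
      ∫ x in (0 : ℝ)..lam, densityTerm k x =
        2 * (meanWeight k * hyperbolaArea (k / (2 * lam))) := by
    intro k hk
    rw [Finset.mem_Icc, Nat.le_floor_iff (by positivity)] at hk
    exact integral_densityTerm hk.1 hk.2
  have heq : ∀ x ∈ Set.uIoc 0 lam,
      ∑ k ∈ Finset.Icc 1 ⌊2 * lam⌋₊, densityTerm k x = density x := by
    intro x hx
    rw [Set.uIoc_of_le hl.le] at hx
    exact (density_eq_sum hx.1 hx.2).symm
  constructor
  · have h1 : IntervalIntegrable (fun x => ∑ k ∈ Finset.Icc 1 ⌊2 * lam⌋₊, densityTerm k x)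
        volume 0 lam := by
      have := IntervalIntegrable.sum (Finset.Icc 1 ⌊2 * lam⌋₊) fun k hk => (hterm k hk).1
      simpa only [Finset.sum_fn] using this
    exact h1.congr heq
  · rw [← intervalIntegral.integral_congr_ae (Eventually.of_forall heq),
      intervalIntegral.integral_finsetSum fun k hk => (hterm k hk).1, halfIntegral, Finset.mul_sum]
    exact Finset.sum_congr rfl fun k hk => (hterm k hk).2

/-! ### From determinants to close pairs -/

open scoped Classical in
/-- The pairs counted by `closePairs` whose first entry is the larger one. -/
def posPairs (I : Set ℝ) (Q : ℕ) (lam : ℝ) : Finset ((ℕ × ℕ) × (ℕ × ℕ)) :=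
  (indices Q ×ˢ indices Q).filter fun ij =>
    point ij.1 ∈ I ∧ point ij.2 ∈ I ∧ 0 < point ij.1 - point ij.2 ∧
      point ij.1 - point ij.2 ≤ lam / numPoints Q

theorem mem_posPairs {I : Set ℝ} {Q : ℕ} {lam : ℝ} {ij : (ℕ × ℕ) × (ℕ × ℕ)} :
    ij ∈ posPairs I Q lam ↔ (ij.1 ∈ indices Q ∧ ij.2 ∈ indices Q) ∧
      point ij.1 ∈ I ∧ point ij.2 ∈ I ∧ 0 < point ij.1 - point ij.2 ∧
      point ij.1 - point ij.2 ≤ lam / numPoints Q := by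
  simp [posPairs]

theorem card_closePairs (I : Set ℝ) (Q : ℕ) (lam : ℝ) :
    (closePairs I Q lam).card = 2 * (posPairs I Q lam).card := by
  classical
  have hunion : closePairs I Q lam =
      posPairs I Q lam ∪ (posPairs I Q lam).map (Equiv.prodComm _ _).toEmbedding := by
    ext ⟨i, j⟩
    simp only [closePairs, Finset.mem_filter, Finset.mem_product, Finset.mem_union, mem_posPairs,
      Finset.mem_map_equiv, Equiv.prodComm_symm, Equiv.prodComm_apply, Prod.swap_prod_mk]
    constructor
    · rintro ⟨⟨h1, h2⟩, h3, h4, _, h5, h6⟩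
      rcases lt_or_gt_of_ne (abs_pos.1 h5) with h | h
      · rw [abs_of_neg h] at h6
        exact Or.inr ⟨⟨h2, h1⟩, h4, h3, by linarith, by linarith⟩
      · rw [abs_of_pos h] at h6
        exact Or.inl ⟨⟨h1, h2⟩, h3, h4, h, h6⟩
    · rintro (⟨⟨h1, h2⟩, h3, h4, h5, h6⟩ | ⟨⟨h2, h1⟩, h4, h3, h5, h6⟩)
      · refine ⟨⟨h1, h2⟩, h3, h4, ?_, ?_, ?_⟩
        · rintro rfl; simp at h5
        · exact abs_pos.2 h5.ne'
        · rwa [abs_of_pos h5]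
      · refine ⟨⟨h1, h2⟩, h3, h4, ?_, ?_, ?_⟩
        · rintro rfl; simp at h5
        · rw [abs_sub_comm]; exact abs_pos.2 h5.ne'
        · rwa [abs_sub_comm, abs_of_pos h5]
  rw [hunion, Finset.card_union_of_disjoint, Finset.card_map, two_mul]
  rw [Finset.disjoint_left]
  rintro ⟨i, j⟩ h h'
  simp only [Finset.mem_map_equiv, Equiv.prodComm_symm, Equiv.prodComm_apply, Prod.swap_prod_mk,
    mem_posPairs] at h h'
  linarith [h.2.2.2.1, h'.2.2.2.1]

theorem point_sub_point {i j : ℕ × ℕ} (hi : 0 < i.2) (hj : 0 < j.2) :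
    point i - point j = ((i.1 : ℝ) * j.2 - j.1 * i.2) / (i.2 * j.2) := by
  have hi' : (i.2 : ℝ) ≠ 0 := by exact_mod_cast hi.ne'
  have hj' : (j.2 : ℝ) ≠ 0 := by exact_mod_cast hj.ne'
  rw [point, point, div_sub_div _ _ hi' hj']
  ring

/-- The exact condition is qq' ≥ kN/λ; since N ≤ Q²/2, the threshold used here is the stronger one.
-/
theorem detPairs_subset_posPairs {I : Set ℝ} {Q k : ℕ} {lam : ℝ} (hl : 0 < lam) (hk : 0 < k)
    (hQ : 2 ≤ Q) :
    detPairs I Q k (k / (2 * lam) * (Q : ℝ) ^ 2) ⊆ posPairs I Q lam := by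
  intro ij hij
  obtain ⟨⟨h1, h2⟩, h3, h4, h5, h6⟩ := mem_detPairs.1 hij
  have hi := mem_indices.1 h1
  have hj := mem_indices.1 h2
  have hq : (0 : ℝ) < ij.1.2 := by exact_mod_cast (by omega : 0 < ij.1.2)
  have hq' : (0 : ℝ) < ij.2.2 := by exact_mod_cast (by omega : 0 < ij.2.2)
  have hk' : (0 : ℝ) < k := by exact_mod_cast hk
  have h5' : (ij.1.1 : ℝ) * ij.2.2 - ij.2.1 * ij.1.2 = k := by
    have : (ij.1.1 : ℝ) * ij.2.2 = ij.2.1 * ij.1.2 + k := by exact_mod_cast h5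
    linarith
  have hQ' : (2 : ℝ) ≤ Q := by exact_mod_cast hQ
  have hN : 0 < numPoints Q := by
    rw [numPoints]
    have : (0 : ℝ) < Q - 1 := by linarith
    positivity
  have hN' : numPoints Q ≤ (Q : ℝ) ^ 2 / 2 := by
    rw [numPoints]
    nlinarith
  refine mem_posPairs.2 ⟨⟨h1, h2⟩, h3, h4, ?_⟩
  rw [point_sub_point (by omega) (by omega), h5']
  refine ⟨by positivity, ?_⟩
  rw [div_le_div_iff₀ (by positivity) hN]
  calc k * numPoints Q ≤ k * ((Q : ℝ) ^ 2 / 2) := by gcongr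
    _ = lam * (k / (2 * lam) * (Q : ℝ) ^ 2) := by field_simp
    _ ≤ lam * (ij.1.2 * ij.2.2) := by gcongr

theorem sum_card_detPairs_le {I : Set ℝ} {Q : ℕ} {lam : ℝ} (hl : 0 < lam) (hQ : 2 ≤ Q) :
    ∑ k ∈ Finset.Icc 1 ⌊2 * lam⌋₊, (detPairs I Q k (k / (2 * lam) * (Q : ℝ) ^ 2)).card ≤
      (posPairs I Q lam).card := by
  classical
  rw [← Finset.card_biUnion]
  · exact Finset.card_le_card (Finset.biUnion_subset.2 fun k hk =>
      detPairs_subset_posPairs hl (Finset.mem_Icc.1 hk).1 hQ)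
  · intro k _ l _ hkl
    refine Finset.disjoint_left.2 fun ij h1 h2 => hkl ?_
    have e1 := (mem_detPairs.1 h1).2.2.2.1
    have e2 := (mem_detPairs.1 h2).2.2.2.1
    omega

theorem eventually_le_card_posPairs {I : Set ℝ} {lam b₁ b₃ : ℝ} (hl : 0 < lam) (hb₁ : 0 ≤ b₁)
    (hb : b₁ ≤ b₃) (hb₃ : b₃ ≤ 1) (hI : Set.Ioo b₁ b₃ ⊆ I) {L : ℝ}
    (hL : L < halfIntegral lam * (b₃ - b₁)) :
    ∀ᶠ Q : ℕ in atTop, L * (Q : ℝ) ^ 2 ≤ ((posPairs I Q lam).card : ℝ) := by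
  set K := ⌊2 * lam⌋₊ with hK
  set ε := (halfIntegral lam * (b₃ - b₁) - L) / (K + 1) with hε
  have hε0 : 0 < ε := div_pos (sub_pos.2 hL) (by positivity)
  have hall : ∀ᶠ Q : ℕ in atTop, ∀ k ∈ Finset.Icc 1 K,
      (meanWeight k * hyperbolaArea (k / (2 * lam)) * (b₃ - b₁) - ε) * (Q : ℝ) ^ 2 ≤
        ((detPairs I Q k (k / (2 * lam) * (Q : ℝ) ^ 2)).card : ℝ) := by
    refine (Finset.eventually_all _).2 fun k hk => ?_
    rw [Finset.mem_Icc, hK, Nat.le_floor_iff (by positivity)] at hk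
    have hk0 : (0 : ℝ) < k := by exact_mod_cast hk.1
    -- When k = 2λ the threshold is c = 1, where the area vanishes and nothing is claimed.
    rcases hk.2.eq_or_lt with h | h
    · refine Eventually.of_forall fun Q => ?_
      rw [h, div_self (by positivity), hyperbolaArea_one]
      refine le_trans (mul_nonpos_of_nonpos_of_nonneg (by linarith) (by positivity)) ?_
      positivity
    · exact eventually_le_card_detPairs hk.1 (by positivity) ((div_lt_one (by positivity)).2 h)
        hb₁ hb hb₃ hI (sub_lt_self _ hε0)
  filter_upwards [hall, eventually_ge_atTop 2] with Q hQ hQ2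
  have h1 := Finset.sum_le_sum hQ
  have h2 : (∑ k ∈ Finset.Icc 1 K, ((detPairs I Q k (k / (2 * lam) * (Q : ℝ) ^ 2)).card : ℝ)) ≤
      ((posPairs I Q lam).card : ℝ) := by
    rw [← Nat.cast_sum]
    exact Nat.cast_le.2 (sum_card_detPairs_le hl hQ2)
  refine le_trans ?_ (h1.trans h2)
  rw [← Finset.sum_mul]
  gcongr
  rw [Finset.sum_sub_distrib, ← Finset.sum_mul, Finset.sum_const, nsmul_eq_mul, Nat.card_Icc,
    Nat.add_sub_cancel]
  have h3 : (K + 1) * ε = halfIntegral lam * (b₃ - b₁) - L := by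
    rw [hε]; field_simp
  have h4 : ∑ k ∈ Finset.Icc 1 K, meanWeight k * hyperbolaArea (k / (2 * lam)) =
    halfIntegral lam := rfl
  rw [h4]
  linarith

/-- From kN ≤ λqq' ≤ λQ² < (⌊2λ⌋ + 1)N one gets k ≤ ⌊2λ⌋. The strict inequality holds for large Q
because N ~ Q²/2. -/
theorem posPairs_subset_biUnion {I : Set ℝ} {Q : ℕ} {lam : ℝ} (hl : 0 < lam) (hQ : 2 ≤ Q)
    (hK : lam * (Q : ℝ) ^ 2 < (⌊2 * lam⌋₊ + 1) * numPoints Q) :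
    posPairs I Q lam ⊆ (Finset.Icc 1 ⌊2 * lam⌋₊).biUnion
      fun k => detPairs I Q k (k * numPoints Q / lam) := by
  intro ij hij
  obtain ⟨⟨h1, h2⟩, h3, h4, h5, h6⟩ := mem_posPairs.1 hij
  have hi := mem_indices.1 h1
  have hj := mem_indices.1 h2
  have hq : (0 : ℝ) < ij.1.2 := by exact_mod_cast (by omega : 0 < ij.1.2)
  have hq' : (0 : ℝ) < ij.2.2 := by exact_mod_cast (by omega : 0 < ij.2.2)
  have hqQ : (ij.1.2 : ℝ) ≤ Q := by exact_mod_cast hi.2.2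
  have hqQ' : (ij.2.2 : ℝ) ≤ Q := by exact_mod_cast hj.2.2
  have hQ' : (2 : ℝ) ≤ Q := by exact_mod_cast hQ
  have hN : 0 < numPoints Q := by
    rw [numPoints]
    have : (0 : ℝ) < Q - 1 := by linarith
    positivity
  rw [point_sub_point (by omega) (by omega)] at h5 h6
  have h7 : (0 : ℝ) < (ij.1.1 : ℝ) * ij.2.2 - ij.2.1 * ij.1.2 := by
    by_contra h
    exact absurd h5 (not_lt.2 (div_nonpos_of_nonpos_of_nonneg (not_lt.1 h) (by positivity)))
  have h8 : ij.2.1 * ij.1.2 < ij.1.1 * ij.2.2 := by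
    have : (ij.2.1 : ℝ) * ij.1.2 < ij.1.1 * ij.2.2 := by linarith
    exact_mod_cast this
  obtain ⟨k, hk⟩ := Nat.exists_eq_add_of_lt h8
  have hk' : ij.1.1 * ij.2.2 = ij.2.1 * ij.1.2 + (k + 1) := by omega
  have hkR : (ij.1.1 : ℝ) * ij.2.2 - ij.2.1 * ij.1.2 = ((k + 1 : ℕ) : ℝ) := by
    have : (ij.1.1 : ℝ) * ij.2.2 = ij.2.1 * ij.1.2 + ((k + 1 : ℕ) : ℝ) := by exact_mod_cast hk'
    linarith
  rw [hkR, div_le_div_iff₀ (by positivity) hN] at h6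
  rw [Finset.mem_biUnion]
  refine ⟨k + 1, Finset.mem_Icc.2 ⟨by omega, ?_⟩, mem_detPairs.2 ⟨⟨h1, h2⟩, h3, h4, hk', ?_⟩⟩
  · have h9 : ((k + 1 : ℕ) : ℝ) * numPoints Q < (⌊2 * lam⌋₊ + 1) * numPoints Q := by
      refine (h6.trans ?_).trans_lt hK
      rw [sq]
      gcongr
    have h10 := lt_of_mul_lt_mul_right h9 hN.le
    have : k + 1 < ⌊2 * lam⌋₊ + 1 := by exact_mod_cast h10
    omega
  · rw [div_le_iff₀ hl]
    linarith

theorem detPairs_anti (I : Set ℝ) (Q k : ℕ) {B B' : ℝ} (h : B ≤ B') :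
    detPairs I Q k B' ⊆ detPairs I Q k B := by
  intro ij hij
  obtain ⟨h1, h3, h4, h5, h6⟩ := mem_detPairs.1 hij
  exact mem_detPairs.2 ⟨h1, h3, h4, h5, h.trans h6⟩

theorem tendsto_numPoints_div_sq :
    Tendsto (fun Q : ℕ => numPoints Q / (Q : ℝ) ^ 2) atTop (𝓝 (1 / 2)) := by
  have h : Tendsto (fun Q : ℕ => (1 - 1 / (Q : ℝ)) / 2) atTop (𝓝 ((1 - 0) / 2)) :=
    (tendsto_const_nhds.sub tendsto_one_div_atTop_nhds_zero_nat).div_const 2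
  rw [sub_zero] at h
  refine h.congr' ?_
  filter_upwards [eventually_gt_atTop 0] with Q hQ
  have hQ' : (Q : ℝ) ≠ 0 := by exact_mod_cast hQ.ne'
  rw [numPoints]
  field_simp

theorem eventually_card_posPairs_le (I : Set ℝ) {lam : ℝ} (hl : 0 < lam) {U : ℝ}
    (hU : halfIntegral lam < U) :
    ∀ᶠ Q : ℕ in atTop, ((posPairs I Q lam).card : ℝ) ≤ U * (Q : ℝ) ^ 2 := by
  set K := ⌊2 * lam⌋₊ with hK
  set ε := (U - halfIntegral lam) / (2 * (K + 1)) with hε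
  have hε0 : 0 < ε := div_pos (sub_pos.2 hU) (by positivity)
  have hall : ∀ᶠ Q : ℕ in atTop, ∀ k ∈ Finset.Icc 1 K,
      ((detPairs I Q k (k * numPoints Q / lam)).card : ℝ) ≤
        (meanWeight k * hyperbolaArea (k / (2 * lam)) + 2 * ε) * (Q : ℝ) ^ 2 := by
    refine (Finset.eventually_all _).2 fun k hk => ?_
    rw [Finset.mem_Icc, hK, Nat.le_floor_iff (by positivity)] at hk
    have hk0 : (0 : ℝ) < k := by exact_mod_cast hk.1
    have hc0 : (0 : ℝ) < k / (2 * lam) := by positivity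
    have hc1 : (k : ℝ) / (2 * lam) ≤ 1 := (div_le_one (by positivity)).2 hk.2
    -- The exact threshold kN/λ is slightly below kQ²/(2λ), so c is taken a little smaller, at a
    -- cost of ε by continuity.
    have hcont : Tendsto (fun c => meanWeight k * hyperbolaArea c) (𝓝[<] (k / (2 * lam)))
        (𝓝 (meanWeight k * hyperbolaArea (k / (2 * lam)))) :=
      ((hasDerivAt_hyperbolaArea hc0).continuousAt.tendsto.const_mul _).mono_left
        nhdsWithin_le_nhds
    obtain ⟨c, ⟨h1, h2⟩, h3⟩ := (((hcont.eventually_lt_const (lt_add_of_pos_right _ hε0)).and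
      (eventually_nhdsWithin_of_eventually_nhds (eventually_gt_nhds hc0))).and
      (eventually_mem_nhdsWithin (a := (k : ℝ) / (2 * lam)) (s := Set.Iio _))).exists
    have h3 : c < k / (2 * lam) := h3
    have hlim : Tendsto (fun Q : ℕ => k / lam * (numPoints Q / (Q : ℝ) ^ 2)) atTop
        (𝓝 (k / lam * (1 / 2))) := tendsto_numPoints_div_sq.const_mul _
    have h4 : c < k / lam * (1 / 2) := by
      refine h3.trans_eq ?_
      field_simp
    filter_upwards [hlim.eventually_const_lt h4, eventually_gt_atTop 0,
      eventually_sum_gcdWeight_hyperbola_le h2 (h3.le.trans hc1) hk.1 hε0] with Q h5 hQ h6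
    have hQ' : (0 : ℝ) < Q := by exact_mod_cast hQ
    have h7 : c * (Q : ℝ) ^ 2 ≤ k * numPoints Q / lam := by
      rw [← mul_div_assoc, lt_div_iff₀ (by positivity)] at h5
      refine h5.le.trans_eq ?_
      ring
    have h8 : ((detPairs I Q k (k * numPoints Q / lam)).card : ℝ) ≤
        ∑ v ∈ (Finset.Icc 1 Q ×ˢ Finset.Icc 1 Q).filter
          (fun v : ℕ × ℕ => c * (Q : ℝ) ^ 2 ≤ (v.1 : ℝ) * v.2), (gcdWeight k v : ℝ) := by
      rw [← Nat.cast_sum]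
      exact Nat.cast_le.2 ((Finset.card_le_card (detPairs_anti I Q k h7)).trans
        (card_detPairs_le I Q k _))
    refine (h8.trans h6).trans (mul_le_mul_of_nonneg_right ?_ (by positivity))
    linarith
  have hKlim : ∀ᶠ Q : ℕ in atTop, lam * (Q : ℝ) ^ 2 < (⌊2 * lam⌋₊ + 1) * numPoints Q := by
    have h1 : lam < (⌊2 * lam⌋₊ + 1) * (1 / 2) := by
      have := Nat.lt_floor_add_one (2 * lam)
      linarith
    filter_upwards [(tendsto_numPoints_div_sq.const_mul ((⌊2 * lam⌋₊ : ℝ) + 1)).eventually_const_lt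
      h1, eventually_gt_atTop 0] with Q h2 hQ
    have hQ' : (0 : ℝ) < Q := by exact_mod_cast hQ
    rwa [← mul_div_assoc, lt_div_iff₀ (by positivity)] at h2
  filter_upwards [hall, hKlim, eventually_ge_atTop 2] with Q h1 h2 h3
  have h4 : ((posPairs I Q lam).card : ℝ) ≤
      ∑ k ∈ Finset.Icc 1 K, ((detPairs I Q k (k * numPoints Q / lam)).card : ℝ) := by
    rw [← Nat.cast_sum]
    exact Nat.cast_le.2 ((Finset.card_le_card (posPairs_subset_biUnion hl h3 h2)).trans
      Finset.card_biUnion_le)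
  refine h4.trans ((Finset.sum_le_sum h1).trans ?_)
  rw [← Finset.sum_mul]
  gcongr
  rw [Finset.sum_add_distrib, Finset.sum_const, nsmul_eq_mul, Nat.card_Icc, Nat.add_sub_cancel]
  have h5 : (K + 1) * (2 * ε) = U - halfIntegral lam := by
    rw [hε]; field_simp
  have h6 : ∑ k ∈ Finset.Icc 1 K, meanWeight k * hyperbolaArea (k / (2 * lam)) =
    halfIntegral lam := rfl
  rw [h6]
  linarith

/-! ### Equidistribution by complementation -/

theorem card_posPairs_add_le {I J : Set ℝ} (hIJ : Disjoint I J) (Q : ℕ) (lam : ℝ) :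
    (posPairs I Q lam).card + (posPairs J Q lam).card ≤ (posPairs (I ∪ J) Q lam).card := by
  classical
  rw [← Finset.card_union_of_disjoint]
  · refine Finset.card_le_card (Finset.union_subset ?_ ?_) <;> intro ij hij <;>
      obtain ⟨h1, h2, h3, h4⟩ := mem_posPairs.1 hij
    · exact mem_posPairs.2 ⟨h1, Or.inl h2, Or.inl h3, h4⟩
    · exact mem_posPairs.2 ⟨h1, Or.inr h2, Or.inr h3, h4⟩
  · refine Finset.disjoint_left.2 fun ij h1 h2 => ?_
    exact Set.disjoint_left.1 hIJ (mem_posPairs.1 h1).2.1 (mem_posPairs.1 h2).2.1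

theorem tendsto_card_posPairs {I : Set ℝ} {a b lam : ℝ} (hl : 0 < lam) (ha : 0 ≤ a) (hab : a ≤ b)
    (hb : b ≤ 1) (hI : Set.Ioo a b ⊆ I) (hI' : I ⊆ Set.Icc a b) :
    Tendsto (fun Q : ℕ => ((posPairs I Q lam).card : ℝ) / (Q : ℝ) ^ 2) atTop
      (𝓝 (halfIntegral lam * (b - a))) := by
  rw [tendsto_order]
  constructor
  · intro L hL
    obtain ⟨L', h1, h2⟩ := exists_between hL
    filter_upwards [eventually_le_card_posPairs hl ha hab hb hI h2, eventually_gt_atTop 0]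
      with Q h3 hQ
    have hQ' : (0 : ℝ) < Q := by exact_mod_cast hQ
    exact h1.trans_le ((le_div_iff₀ (by positivity)).2 h3)
  -- The upper bound for I is the global one, `halfIntegral lam` + ε, minus the lower bounds for (0,
  -- a) and (b, 1), each short by ε; the total error 3ε is less than 4ε.
  · intro U hU
    set ε := (U - halfIntegral lam * (b - a)) / 4 with hε
    have hε0 : 0 < ε := div_pos (sub_pos.2 hU) (by norm_num)
    have d1 : Disjoint (Set.Ioo 0 a) I := Set.disjoint_left.2 fun x h1 h2 =>
      absurd (hI' h2).1 (not_le.2 h1.2)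
    have d2 : Disjoint (Set.Ioo 0 a ∪ I) (Set.Ioo b 1) := Set.disjoint_left.2 fun x h1 h2 => by
      rcases h1 with h1 | h1
      · exact absurd (h1.2.trans_le hab) (not_lt.2 h2.1.le)
      · exact absurd (hI' h1).2 (not_le.2 h2.1)
    filter_upwards [eventually_card_posPairs_le ((Set.Ioo 0 a ∪ I) ∪ Set.Ioo b 1) hl
        (lt_add_of_pos_right _ hε0),
      eventually_le_card_posPairs hl le_rfl ha (hab.trans hb) subset_rfl (sub_lt_self _ hε0),
      eventually_le_card_posPairs hl (ha.trans hab) hb le_rfl subset_rfl (sub_lt_self _ hε0),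
      eventually_gt_atTop 0] with Q h1 h2 h3 hQ
    have hQ' : (0 : ℝ) < Q := by exact_mod_cast hQ
    have h4 : ((posPairs (Set.Ioo 0 a) Q lam).card : ℝ) + (posPairs I Q lam).card ≤
        (posPairs (Set.Ioo 0 a ∪ I) Q lam).card := by
      exact_mod_cast card_posPairs_add_le d1 Q lam
    have h5 : ((posPairs (Set.Ioo 0 a ∪ I) Q lam).card : ℝ) +
        (posPairs (Set.Ioo b 1) Q lam).card ≤
        (posPairs ((Set.Ioo 0 a ∪ I) ∪ Set.Ioo b 1) Q lam).card := by
      exact_mod_cast card_posPairs_add_le d2 Q lam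
    have hQ2 : 0 < (Q : ℝ) ^ 2 := by positivity
    rw [div_lt_iff₀ hQ2]
    have h6 : U = halfIntegral lam * (b - a) + 4 * ε := by rw [hε]; ring
    have h7 := mul_pos hε0 hQ2
    rw [h6]
    linarith

theorem tendsto_pairCorr {I : Set ℝ} {a b lam : ℝ} (hl : 0 < lam) (ha : 0 ≤ a) (hab : a < b)
    (hb : b ≤ 1) (hI : Set.Ioo a b ⊆ I) (hI' : I ⊆ Set.Icc a b) :
    Tendsto (fun Q : ℕ => pairCorr I Q lam) atTop (𝓝 (2 * halfIntegral lam)) := by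
  have hvol : volume.real I = b - a := by
    refine le_antisymm ?_ ?_
    · rw [← Real.volume_real_Icc_of_le hab.le]
      exact measureReal_mono hI' measure_Icc_lt_top.ne
    · rw [← Real.volume_real_Ioo_of_le hab.le]
      exact measureReal_mono hI ((measure_mono hI').trans_lt measure_Icc_lt_top).ne
  have hba : 0 < b - a := sub_pos.2 hab
  have h := ((tendsto_card_posPairs hl ha hab.le hb hI hI').div tendsto_numPoints_div_sq
    (by norm_num)).div_const (b - a)
  have hlim : halfIntegral lam * (b - a) / (1 / 2) / (b - a) = 2 * halfIntegral lam := by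
    field_simp
  rw [hlim] at h
  refine h.congr' ?_
  filter_upwards [eventually_gt_atTop 0] with Q hQ
  have hQ' : (Q : ℝ) ≠ 0 := by exact_mod_cast hQ.ne'
  simp only [Pi.div_apply]
  rw [pairCorr, card_closePairs, hvol]
  push_cast
  rw [div_div_div_cancel_right₀ (by positivity), div_div, mul_assoc 2 (numPoints Q),
    mul_div_mul_left _ _ two_ne_zero]

end FracPairCorr

end

theorem mainTheorem2 (I : Set ℝ) (hconn : I.OrdConnected) (hne : I.Nontrivial)
    (hI : I ⊆ Set.Ioo (0 : ℝ) 1) :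
    FracPairCorr.IsPairCorrelationFunction I FracPairCorr.density := by
  intro lam hl
  obtain ⟨hint, heq⟩ := FracPairCorr.integral_density hl
  refine ⟨hint, ?_⟩
  rw [heq]
  have hbelow : BddBelow I := ⟨0, fun x hx => (hI hx).1.le⟩
  have habove : BddAbove I := ⟨1, fun x hx => (hI hx).2.le⟩
  have hnon := hne.nonempty
  obtain ⟨x, hx, y, hy, hxy⟩ := hne.exists_lt
  refine FracPairCorr.tendsto_pairCorr (a := sInf I) (b := sSup I) hl
    (le_csInf hnon fun x hx => (hI hx).1.le)
    ((csInf_le hbelow hx).trans_lt (hxy.trans_le (le_csSup habove hy)))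
    (csSup_le hnon fun x hx => (hI hx).2.le) ?_
    fun x hx => ⟨csInf_le hbelow hx, le_csSup habove hx⟩
  rintro z ⟨h1, h2⟩
  obtain ⟨u, hu, huz⟩ := exists_lt_of_csInf_lt hnon h1
  obtain ⟨v, hv, hzv⟩ := exists_lt_of_lt_csSup hnon h2
  exact hconn.out hu hv ⟨huz.le, hzv.le⟩
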